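/- Conventions. A conflation category is an additive category with a chosen class, closed under isomorphisms, of kernel-cokernel pairs $A\xrightarrow{f}B\xrightarrow{g}C$ (conflations); then $f$ is called an inflation and $g$ a deflation. It is right exact if the identity of a zero object is a deflation, deflations are closed under composition, and the pullback of a deflation along any morphism exists and is a deflation. Axiom R0* says that every morphism $A\to 0$ is a deflation. Axiom R3 says: if $p$ has a kernel and $p\circ i$ is a deflation, then $p$ is a deflation. An additive functor is exact if it preserves conflations. An additive category is weakly idempotent complete if every retraction has a kernel. The weak idempotent completion $\widehat{\mathcal E}$ of an additive category $\mathcal E$ is the intersection of all full replete additive subcategories of the idempotent completion $\check{\mathcal E}$ that contain $\mathcal E$ and are weakly idempotent complete; $j\colon\mathcal E\to\widehat{\mathcal E}$ is the embedding. A complex $X^\bullet$ is acyclic if each differential $d^{n-1}\colon X^{n-1}\to X^n$ factors as a deflation that is a cokernel of $d^{n-2}$ followed by an inflation that is a kernel of $d^{n}$. The bounded derived category $\mathbf D^b(\mathcal E)=\mathbf K^b(\mathcal E)/\mathbf{Ac}^b(\mathcal E)$ is the Verdier quotient of the bounded homotopy category by the (thick subcategory generated by the) bounded acyclic complexes. Theorem.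 Let $\mathcal E$ be a right exact category satisfying R0*. Then $\widehat{\mathcal E}$ is weakly idempotent complete, $j$ is fully faithful, and the following hold. 1. Call a sequence in $\widehat{\mathcal E}$ a conflation if it is, in the category of sequences in $\check{\mathcal E}$, a direct summand of a conflation of $\mathcal E$. This makes $\widehat{\mathcal E}$ a right exact category satisfying R3, and $j$ is exact. Moreover $j$ is $2$-universal among exact functors to weakly idempotent complete right exact categories satisfying R3: for every exact functor $F\colon\mathcal E\to\mathcal W$ to such a category there are an exact functor $\widehat F\colon\widehat{\mathcal E}\to\mathcal W$ and a natural isomorphism $\alpha\colon F\to\widehat F j$ such that for every exact functor $G\colon\widehat{\mathcal E}\to\mathcal W$ and every natural transformation $\gamma\colon F\Rightarrow Gj$ there is a unique natural transformation $\beta\colon\widehat F\Rightarrow G$ with $\gamma=(\beta j)\circ\alpha$. 2. The embedding $j$ lifts to a triangle equivalence $\Phi\colon\mathbf D^b(\mathcal E)\to\mathbf D^b(\widehat{\mathcal E})$: there is a natural isomorphism, compatible with the shifts, between the composite $\mathbf K^b(\mathcal E)\to\mathbf D^b(\mathcal E)\xrightarrow{\Phi}\mathbf D^b(\widehat{\mathcal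 E})$ and the composite $\mathbf K^b(\mathcal E)\xrightarrow{j}\mathbf K^b(\widehat{\mathcal E})\to\mathbf D^b(\widehat{\mathcal E})$, and consequently $\Phi$ restricts along the canonical functors $\mathcal E\to\mathbf D^b(\mathcal E)$ and $\widehat{\mathcal E}\to\mathbf D^b(\widehat{\mathcal E})$ (stalk complexes in degree $0$) to $j$, up to natural isomorphism. -/

import Mathlib

open CategoryTheory CategoryTheory.Limits CategoryTheory.Idempotents
open scoped ZeroObject

universe w' w v u v₂ u₂

namespace RightExact

noncomputable section

section Conflations

variable (C : Type u) [Category.{v} C] [Preadditive C]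

/-- An additive category is weakly idempotent complete if every retraction has a kernel. -/
def WeaklyIdempotentComplete : Prop :=
  ∀ ⦃B C' : C⦄ (r : B ⟶ C') (s : C' ⟶ B), s ≫ r = 𝟙 C' → HasKernel r

/-- A chosen class of kernel-cokernel pairs, closed under isomorphisms. A sequence is encoded as a
`ShortComplex`, that is as two composable morphisms `f`, `g` with `f ≫ g = 0`. -/
structure ConflationStructure where
  /-- the chosen class of sequences -/
  conflation : ObjectProperty (ShortComplex C)
  isKernel : ∀ S, conflation S → Nonempty (IsLimit (KernelFork.ofι S.f S.zero))
  isCokernel : ∀ S, conflation S → Nonempty (IsColimit (CokernelCofork.ofπ S.g S.zero))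
  of_iso : ∀ {S T : ShortComplex C}, (S ≅ T) → conflation S → conflation T

variable {C}

namespace ConflationStructure

variable (e : ConflationStructure C)

/-- Inflations: the first morphisms of conflations. -/
def IsInflation {X Y : C} (f : X ⟶ Y) : Prop :=
  ∃ (Z : C) (g : Y ⟶ Z) (zero : f ≫ g = 0), e.conflation (ShortComplex.mk f g zero)

/-- Deflations: the second morphisms of conflations. -/
def IsDeflation {Y Z : C} (g : Y ⟶ Z) : Prop :=
  ∃ (X : C) (f : X ⟶ Y) (zero : f ≫ g = 0), e.conflation (ShortComplex.mk f g zero)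

/-- Every morphism to a zero object is a deflation. -/
def R0Star : Prop := ∀ ⦃A Z : C⦄ (f : A ⟶ Z), IsZero Z → e.IsDeflation f

/-- If `p` has a kernel and the composite `p ∘ i` is a deflation, then `p` is a deflation. -/
def R3 : Prop := ∀ ⦃A B C' : C⦄ (i : A ⟶ B) (p : B ⟶ C'),
  HasKernel p → e.IsDeflation (i ≫ p) → e.IsDeflation p

end ConflationStructure

variable (C) in
/-- A right exact (deflation-exact) structure on an additive category. -/
structure RightExactStructure extends ConflationStructure C where
  /-- the identity of a zero object is a deflation -/
  r0 : ∀ Z : C, IsZero Z → toConflationStructure.IsDeflation (𝟙 Z)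
  /-- deflations are closed under composition -/
  r1 : ∀ ⦃X Y Z : C⦄ (f : X ⟶ Y) (g : Y ⟶ Z), toConflationStructure.IsDeflation f →
    toConflationStructure.IsDeflation g → toConflationStructure.IsDeflation (f ≫ g)
  /-- pullbacks of deflations along arbitrary morphisms exist and are deflations -/
  r2 : ∀ ⦃Y Z W : C⦄ (g : Y ⟶ W) (h : Z ⟶ W), toConflationStructure.IsDeflation g →
    ∃ (X : C) (a : X ⟶ Y) (b : X ⟶ Z), IsPullback a b g h ∧ toConflationStructure.IsDeflation b

theorem RightExactStructure.isDeflation_of_isZero (e : RightExactStructure C) {X Y : C} (f : X ⟶ Y) (hX : IsZero X) (hY : IsZero Y) :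
    e.IsDeflation f := by
  obtain ⟨K, k, h, hk⟩ := e.r0 X hX
  refine ⟨K, k, hY.eq_of_tgt _ _, e.of_iso ?_ hk⟩
  exact ShortComplex.isoMk (Iso.refl _) (Iso.refl _) (hX.iso hY) (by simp) (hY.eq_of_tgt _ _)

theorem RightExactStructure.isInflation_of_isZero (e : RightExactStructure C) {X Y : C} (f : X ⟶ Y) (hX : IsZero X) (hY : IsZero Y) :
    e.IsInflation f := by
  obtain ⟨K, k, h, hk⟩ := e.r0 Y hY
  have hK : IsZero K := by
    obtain ⟨l⟩ := e.isKernel _ hk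
    rw [IsZero.iff_id_eq_zero]
    exact Fork.IsLimit.hom_ext l (hY.eq_of_tgt _ _)
  refine ⟨Y, 𝟙 Y, hY.eq_of_tgt _ _, e.of_iso ?_ hk⟩
  exact ShortComplex.isoMk (hK.iso hX) (Iso.refl _) (Iso.refl _) (hY.eq_of_tgt _ _) (by simp)

/-- An additive functor is exact if it sends conflations to conflations. -/
def IsExact {D : Type u₂} [Category.{v₂} D] [Preadditive D]
    (e : RightExactStructure C) (e' : RightExactStructure D) (F : C ⥤ D) : Prop :=
  ∃ _ : F.Additive, ∀ S : ShortComplex C, e.conflation S → e'.conflation (S.map F)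

/-- `j` is `2`-universal among exact functors to weakly idempotent complete right exact
categories satisfying `R3`. -/
def IsTwoUniversal {D : Type u₂} [Category.{v₂} D] [Preadditive D]
    (e : RightExactStructure C) (e' : RightExactStructure D) (j : C ⥤ D) : Prop :=
  ∀ (W : Type w) [Category.{w'} W] [Preadditive W] [HasZeroObject W] [HasBinaryBiproducts W]
    (eW : RightExactStructure W), WeaklyIdempotentComplete W → eW.R3 →
    ∀ F : C ⥤ W, IsExact e eW F →
      ∃ (F' : D ⥤ W) (α : F ≅ j ⋙ F'), IsExact e' eW F' ∧
        ∀ G : D ⥤ W, IsExact e' eW G → ∀ γ : F ⟶ j ⋙ G,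
          ∃! β : F' ⟶ G, γ = α.hom ≫ Functor.whiskerLeft j β

/-- The conflations of the idempotent completion: the direct summands of conflations of `C`.
As idempotents split in `Karoubi C`, every retract of a sequence in `Karoubi C` is a direct
summand of it. -/
def RightExactStructure.karoubiConflation (e : RightExactStructure C) :
    ObjectProperty (ShortComplex (Karoubi C)) :=
  fun S => ∃ T : ShortComplex C, e.conflation T ∧ Nonempty (Retract S (T.map (toKaroubi C)))

end Conflations

section WeakIdempotentCompletion

variable (C : Type u) [Category.{v} C] [Preadditive C] [HasZeroObject C] [HasBinaryBiproducts C]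

/-- The (full, replete) additive subcategories of the idempotent completion that contain `C`
and are weakly idempotent complete. -/
structure IsWeaklyIdempotentCompleteEnvelope (P : ObjectProperty (Karoubi C)) : Prop where
  additive : P.IsClosedUnderFiniteProducts
  contains : ∀ X : C, P ((toKaroubi C).obj X)
  complete : WeaklyIdempotentComplete P.FullSubcategory

/-- The intersection of all weakly idempotent complete additive subcategories of the idempotent
completion that contain `C`. -/
def weakIdempotentHull : ObjectProperty (Karoubi C) :=
  fun X => ∀ P : ObjectProperty (Karoubi C), IsWeaklyIdempotentCompleteEnvelope C P → P X

instance : (weakIdempotentHull C).IsClosedUnderFiniteProducts where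
  isClosedUnderLimitsOfShape J _ :=
    { limitsOfShape_le := by
        rintro X ⟨p⟩ P hP
        have := hP.additive
        exact P.prop_of_isLimit p.isLimit (fun j => p.prop_diag_obj j P hP) }

/-- The weak idempotent completion of an additive category. -/
abbrev WeakIdempotentCompletion : Type (max u v) := (weakIdempotentHull C).FullSubcategory

theorem hasFiniteBiproducts_weakIdempotentCompletion :
    HasFiniteBiproducts (WeakIdempotentCompletion C) :=
  have : HasFiniteProducts C := hasFiniteProducts_of_has_binary_and_terminal
  have : HasFiniteBiproducts C := HasFiniteBiproducts.of_hasFiniteProducts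
  HasFiniteBiproducts.of_hasFiniteProducts

instance : HasZeroObject (WeakIdempotentCompletion C) :=
  have := hasFiniteBiproducts_weakIdempotentCompletion C
  inferInstance

instance : HasBinaryBiproducts (WeakIdempotentCompletion C) :=
  have := hasFiniteBiproducts_weakIdempotentCompletion C
  hasBinaryBiproducts_of_finite_biproducts _

/-- The embedding of `C` into its weak idempotent completion. -/
abbrev toWeakIdempotentCompletion : C ⥤ WeakIdempotentCompletion C :=
  (weakIdempotentHull C).lift (toKaroubi C) (fun X _ hP => hP.contains X)

instance : (toWeakIdempotentCompletion C).Additive where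
  map_add := by
    intro X Y f g
    exact ObjectProperty.hom_ext _ ((toKaroubi C).map_add)

end WeakIdempotentCompletion

section BoundedHomotopyCategory

theorem isStrictlyLE_mappingCone {C : Type u} [Category.{v} C] [Preadditive C]
    [HasBinaryBiproducts C] {K L : CochainComplex C ℤ} (f : K ⟶ L) (b₁ b₂ b : ℤ)
    [K.IsStrictlyLE b₁] [L.IsStrictlyLE b₂] (h₁ : b₁ ≤ b) (h₂ : b₂ ≤ b) :
    (CochainComplex.mappingCone f).IsStrictlyLE b := by
  rw [CochainComplex.isStrictlyLE_iff]
  intro i hi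
  simp only [CochainComplex.mappingCone.isZero_X_iff]
  exact ⟨K.isZero_of_isStrictlyLE b₁ _, L.isZero_of_isStrictlyLE b₂ _⟩

variable (C : Type u) [Category.{v} C] [Preadditive C] [HasZeroObject C] [HasBinaryBiproducts C]

/-- The bounded cochain complexes, as objects of the homotopy category. -/
def bounded : ObjectProperty (HomotopyCategory C (ComplexShape.up ℤ)) :=
  fun X => ∃ a b : ℤ, CochainComplex.IsStrictlyGE X.as a ∧ CochainComplex.IsStrictlyLE X.as b

instance : (bounded C).ContainsZero where
  exists_zero :=
    ⟨(HomotopyCategory.quotient _ _).obj 0, Functor.map_isZero _ (isZero_zero _), 0, 0,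
      inferInstanceAs (CochainComplex.IsStrictlyGE (0 : CochainComplex C ℤ) 0),
      inferInstanceAs (CochainComplex.IsStrictlyLE (0 : CochainComplex C ℤ) 0)⟩

instance : (bounded C).IsStableUnderShift ℤ where
  isStableUnderShiftBy n :=
    { le_shift := by
        rintro X hX
        obtain ⟨K, rfl⟩ := X.quotient_obj_surjective
        obtain ⟨a, b, ha, hb⟩ := hX
        replace ha : CochainComplex.IsStrictlyGE K a := ha
        replace hb : CochainComplex.IsStrictlyLE K b := hb
        rw [ObjectProperty.prop_shift_iff, HomotopyCategory.shift_quotient_obj]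
        exact ⟨a - n, b - n, CochainComplex.isStrictlyGE_shift K a n (a - n) (by lia),
          CochainComplex.isStrictlyLE_shift K b n (b - n) (by lia)⟩ }

instance : (bounded C).IsTriangulatedClosed₃ where
  ext₃' T hT h₁ h₂ := by
    obtain ⟨a₁, b₁, ha₁, hb₁⟩ := h₁
    obtain ⟨a₂, b₂, ha₂, hb₂⟩ := h₂
    obtain ⟨f : T.obj₁.as ⟶ T.obj₂.as, hf⟩ :=
      (HomotopyCategory.quotient _ _).map_surjective T.mor₁
    refine ⟨(HomotopyCategory.quotient _ _).obj (CochainComplex.mappingCone f),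
      ⟨min (a₁ - 1) a₂, max b₁ b₂,
        CochainComplex.isStrictlyGE_mappingCone f a₁ a₂ _ (by lia) (by lia),
        isStrictlyLE_mappingCone f b₁ b₂ _ (by lia) (by lia)⟩,
      ⟨Pretriangulated.Triangle.π₃.mapIso (Pretriangulated.isoTriangleOfIso₁₂ T _ hT
        (HomotopyCategory.mappingCone_triangleh_distinguished f)
        (Iso.refl _) (Iso.refl _) ?_)⟩⟩
    exact (Category.comp_id _).trans (hf.symm.trans (Category.id_comp _).symm)

instance : (bounded C).IsTriangulated where
  toIsTriangulatedClosed₂ := .of_isTriangulatedClosed₃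

/-- The bounded homotopy category. -/
abbrev Kb : Type (max u v) := (bounded C).FullSubcategory

/-- The stalk complexes concentrated in degree zero. -/
def stalk : C ⥤ Kb C :=
  (bounded C).lift (HomotopyCategory.singleFunctor C 0) (fun X => ⟨0, 0,
    inferInstanceAs (CochainComplex.IsStrictlyGE ((CochainComplex.singleFunctor C 0).obj X) 0),
    inferInstanceAs (CochainComplex.IsStrictlyLE ((CochainComplex.singleFunctor C 0).obj X) 0)⟩)

variable {C} {D : Type u₂} [Category.{v₂} D] [Preadditive D] [HasZeroObject D] [HasBinaryBiproducts D]

/-- The functor between bounded homotopy categories that applies an additive functor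
degreewise. -/
def mapKb (F : C ⥤ D) [F.Additive] : Kb C ⥤ Kb D :=
  (bounded D).lift ((bounded C).ι ⋙ F.mapHomotopyCategory (ComplexShape.up ℤ)) (by
    rintro ⟨X, a, b, ha, hb⟩
    exact ⟨a, b,
      inferInstanceAs (CochainComplex.IsStrictlyGE
        ((F.mapHomologicalComplex (ComplexShape.up ℤ)).obj X.as) a),
      inferInstanceAs (CochainComplex.IsStrictlyLE
        ((F.mapHomologicalComplex (ComplexShape.up ℤ)).obj X.as) b)⟩)

instance (F : C ⥤ D) [F.Additive] : (mapKb F).CommShift ℤ :=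
  inferInstanceAs (((bounded D).lift ((bounded C).ι ⋙
    F.mapHomotopyCategory (ComplexShape.up ℤ)) _).CommShift ℤ)

end BoundedHomotopyCategory

section BoundedDerivedCategory

variable {C : Type u} [Category.{v} C] [Preadditive C] [HasZeroObject C] [HasBinaryBiproducts C]

namespace RightExactStructure

variable (e : RightExactStructure C)

/-- A complex is acyclic in degree `n` if the differential `Xⁿ⁻¹ ⟶ Xⁿ` factors as a deflation,
which is a cokernel of the preceding differential, followed by an inflation, which is a kernel of
the next differential. -/
def AcyclicAt (X : CochainComplex C ℤ) (n : ℤ) : Prop :=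
  ∃ (Z : C) (p : X.X (n - 1) ⟶ Z) (i : Z ⟶ X.X n), p ≫ i = X.d (n - 1) n ∧
    e.IsDeflation p ∧ e.IsInflation i ∧
    (∃ h : X.d (n - 2) (n - 1) ≫ p = 0, Nonempty (IsColimit (CokernelCofork.ofπ p h))) ∧
    (∃ h : i ≫ X.d n (n + 1) = 0, Nonempty (IsLimit (KernelFork.ofι i h)))

/-- A complex is acyclic if it is acyclic in each degree. -/
def Acyclic (X : CochainComplex C ℤ) : Prop := ∀ n : ℤ, e.AcyclicAt X n

/-- The bounded acyclic complexes, as objects of the bounded homotopy category. -/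
def acyclicKb : ObjectProperty (Kb C) := fun X => e.Acyclic X.obj.as

instance : e.acyclicKb.Nonempty := by
  let Z : Kb C := ⟨(HomotopyCategory.quotient _ _).obj (0 : CochainComplex C ℤ), 0, 0,
      inferInstanceAs (CochainComplex.IsStrictlyGE (0 : CochainComplex C ℤ) 0),
      inferInstanceAs (CochainComplex.IsStrictlyLE (0 : CochainComplex C ℤ) 0)⟩
  have hZ : ∀ n, IsZero (Z.obj.as.X n) := fun n =>
    (HomologicalComplex.eval C (ComplexShape.up ℤ) n).map_isZero
      (isZero_zero (CochainComplex C ℤ))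
  refine ⟨Z, fun n => ⟨Z.obj.as.X n, Z.obj.as.d _ _, 𝟙 _, Category.comp_id _,
    e.isDeflation_of_isZero _ (hZ _) (hZ _), e.isInflation_of_isZero _ (hZ _) (hZ _),
    ⟨(hZ _).eq_of_tgt _ _, ⟨?_⟩⟩, ⟨(hZ _).eq_of_tgt _ _, ⟨?_⟩⟩⟩⟩
  · exact CokernelCofork.IsColimit.ofπ _ _ (fun _ _ => 0) (fun _ _ => (hZ _).eq_of_src _ _)
      (fun _ _ _ _ => (hZ _).eq_of_src _ _)
  · exact KernelFork.IsLimit.ofι _ _ (fun _ _ => 0) (fun _ _ => (hZ _).eq_of_tgt _ _)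
      (fun _ _ _ _ => (hZ _).eq_of_tgt _ _)

/-- The weak quasi-isomorphisms: the morphisms of the bounded homotopy category whose cone lies
in the thick closure of the bounded acyclic complexes. -/
abbrev quasiIso : MorphismProperty (Kb C) := e.acyclicKb.triangEnvelope.trW

/-- The bounded derived category: the Verdier quotient of the bounded homotopy category by the
(thick subcategory generated by the) bounded acyclic complexes. -/
abbrev Db : Type (max u v) := e.quasiIso.Localization

/-- The Verdier localization functor. -/
abbrev Qb : Kb C ⥤ e.Db := e.quasiIso.Q

/-- The canonical functor from a right exact category to its bounded derived category. -/
abbrev toDb : C ⥤ e.Db := stalk C ⋙ e.Qb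

end RightExactStructure

end BoundedDerivedCategory

end

end RightExact

/-! Everything rests on one property of `j`: each object X of the completion has a complement in the
image, X ⊞ jA ≅ jB. The objects with such a complement form a weakly idempotent complete subcategory
of the idempotent completion, so the hull lies inside it. The main arguments use only that `j` is
additive and fully faithful, that its target is weakly idempotent complete, and that complements
exist.

R0* makes the row (f, q) a deflation as soon as q is one (`isDeflation_biprod_desc`). Hence a
morphism of the completion is a deflation exactly if it has a kernel and every map from some jW to
its target lifts through it after precomposition with a deflation V ⟶ W
(`isDeflation_retractConflationStructure_iff`). In this form R3 and the stability of the lifting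
condition under composition and pullback are formal. The real work is the existence of pullbacks,
`LiftsDeflations.exists_isPullback`: a pullback computed in the original category contains the
desired one as a direct summand with an explicit complement, so it can be split off.

For universality, a functor is extended by splitting the images of idempotents; the complements
guarantee that these split in the target. R3 makes conflations there stable under retracts, so the
extension is exact.

For derived categories, adding a contractible complex moves any bounded complex over the completion
into the image of `j`, so `mapKb j` is already an equivalence. By
`LiftsDeflations.exists_isDeflationImage` the same padding can be chosen to respect the conflations
of an acyclic complex, so acyclic complexes come from acyclic complexes. The thick closures then
correspond, and so do the Verdier quotients. -/

open CategoryTheory CategoryTheory.Limits CategoryTheory.Idempotents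
open scoped ZeroObject

namespace RightExact

noncomputable section

set_option linter.unusedSectionVars false

/-! ### Kernels and cokernels as propositions. -/

section KernelPairs

variable {C : Type u} [Category.{v} C] [Preadditive C]

/-- The morphism `f` is a kernel of `g`. -/
structure IsKer {X Y Z : C} (f : X ⟶ Y) (g : Y ⟶ Z) : Prop where
  zero : f ≫ g = 0
  mono : Mono f
  lift : ∀ ⦃T : C⦄ (t : T ⟶ Y), t ≫ g = 0 → ∃ l : T ⟶ X, l ≫ f = t

/-- The morphism `g` is a cokernel of `f`. -/
structure IsCoker {X Y Z : C} (f : X ⟶ Y) (g : Y ⟶ Z) : Prop where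
  zero : f ≫ g = 0
  epi : Epi g
  desc : ∀ ⦃T : C⦄ (t : Y ⟶ T), f ≫ t = 0 → ∃ l : Z ⟶ T, g ≫ l = t

theorem isKer_iff {X Y Z : C} {f : X ⟶ Y} {g : Y ⟶ Z} (w : f ≫ g = 0) :
    IsKer f g ↔ Nonempty (IsLimit (KernelFork.ofι f w)) := by
  constructor
  · intro h
    have := h.mono
    exact ⟨KernelFork.IsLimit.ofι' f w (fun t ht => ⟨(h.lift t ht).choose, (h.lift t ht).choose_spec⟩)⟩
  · rintro ⟨l⟩
    exact ⟨w, ⟨fun a b hab => Fork.IsLimit.hom_ext l hab⟩,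
      fun T t ht => ⟨_, (KernelFork.IsLimit.lift' l t ht).2⟩⟩

theorem isCoker_iff {X Y Z : C} {f : X ⟶ Y} {g : Y ⟶ Z} (w : f ≫ g = 0) :
    IsCoker f g ↔ Nonempty (IsColimit (CokernelCofork.ofπ g w)) := by
  constructor
  · intro h
    have := h.epi
    exact ⟨CokernelCofork.IsColimit.ofπ' g w
      (fun t ht => ⟨(h.desc t ht).choose, (h.desc t ht).choose_spec⟩)⟩
  · rintro ⟨l⟩
    exact ⟨w, ⟨fun a b hab => Cofork.IsColimit.hom_ext l hab⟩,
      fun T t ht => ⟨_, (CokernelCofork.IsColimit.desc' l t ht).2⟩⟩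

theorem hasKernel_iff {Y Z : C} {g : Y ⟶ Z} :
    HasKernel g ↔ ∃ (X : C) (f : X ⟶ Y), IsKer f g := by
  constructor
  · intro _
    exact ⟨_, kernel.ι g, (isKer_iff (kernel.condition g)).2
      ⟨(kernelIsKernel g)⟩⟩
  · rintro ⟨X, f, h⟩
    obtain ⟨l⟩ := (isKer_iff h.zero).1 h
    exact ⟨⟨_, l⟩⟩

theorem IsKer.exists_iso {X X' Y Z : C} {f : X ⟶ Y} {f' : X' ⟶ Y} {g : Y ⟶ Z}
    (h : IsKer f g) (h' : IsKer f' g) : ∃ φ : X ≅ X', φ.hom ≫ f' = f := by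
  obtain ⟨a, ha⟩ := h'.lift f h.zero
  obtain ⟨b, hb⟩ := h.lift f' h'.zero
  have := h.mono
  have := h'.mono
  exact ⟨⟨a, b, by simp [← cancel_mono f, ha, hb], by simp [← cancel_mono f', ha, hb]⟩, ha⟩

theorem IsKer.of_retract {S T : ShortComplex C} (R : Retract S T) (h : IsKer T.f T.g) :
    IsKer S.f S.g := by
  have := h.mono
  have r₁ : R.i.τ₁ ≫ R.r.τ₁ = 𝟙 _ := by rw [← ShortComplex.comp_τ₁, R.retract]; rfl
  have r₂ : R.i.τ₂ ≫ R.r.τ₂ = 𝟙 _ := by rw [← ShortComplex.comp_τ₂, R.retract]; rfl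
  have : Mono (R.i.τ₁ ≫ T.f) := by
    have : Mono R.i.τ₁ := (SplitMono.mk R.r.τ₁ r₁).mono
    infer_instance
  refine ⟨S.zero, ?_, fun U t ht => ?_⟩
  · rw [R.i.comm₁₂] at this
    exact mono_of_mono S.f R.i.τ₂
  · obtain ⟨l, hl⟩ := h.lift (t ≫ R.i.τ₂) (by rw [Category.assoc, R.i.comm₂₃, reassoc_of% ht, zero_comp])
    exact ⟨l ≫ R.r.τ₁, by rw [Category.assoc, R.r.comm₁₂, reassoc_of% hl, r₂, Category.comp_id]⟩

theorem IsCoker.of_retract {S T : ShortComplex C} (R : Retract S T) (h : IsCoker T.f T.g) :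
    IsCoker S.f S.g := by
  have := h.epi
  have r₂ : R.i.τ₂ ≫ R.r.τ₂ = 𝟙 _ := by rw [← ShortComplex.comp_τ₂, R.retract]; rfl
  have r₃ : R.i.τ₃ ≫ R.r.τ₃ = 𝟙 _ := by rw [← ShortComplex.comp_τ₃, R.retract]; rfl
  have : Epi (T.g ≫ R.r.τ₃) := by
    have : Epi R.r.τ₃ := (SplitEpi.mk R.i.τ₃ r₃).epi
    infer_instance
  refine ⟨S.zero, ?_, fun U t ht => ?_⟩
  · rw [← R.r.comm₂₃] at this
    exact epi_of_epi R.r.τ₂ S.g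
  · obtain ⟨l, hl⟩ := h.desc (R.r.τ₂ ≫ t) (by rw [← R.r.comm₁₂_assoc, ht, comp_zero])
    exact ⟨R.i.τ₃ ≫ l, by rw [← R.i.comm₂₃_assoc, hl, reassoc_of% r₂]⟩

theorem IsKer.comp_mono {X Y Z W : C} {f : X ⟶ Y} {g : Y ⟶ Z} (m : Z ⟶ W) [Mono m]
    (h : IsKer f g) : IsKer f (g ≫ m) :=
  ⟨by rw [reassoc_of% h.zero, zero_comp], h.mono, fun T t ht => h.lift t (by
    rw [← cancel_mono m, Category.assoc, ht, zero_comp])⟩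

theorem IsKer.of_comp_mono {X Y Z W : C} {f : X ⟶ Y} {g : Y ⟶ Z} (m : Z ⟶ W) [Mono m]
    (h : IsKer f (g ≫ m)) : IsKer f g :=
  ⟨by rw [← cancel_mono m, Category.assoc, h.zero, zero_comp], h.mono,
    fun T t ht => h.lift t (by rw [reassoc_of% ht, zero_comp])⟩

theorem IsCoker.epi_comp {X Y Z W : C} {f : X ⟶ Y} {g : Y ⟶ Z} (m : W ⟶ X) [Epi m]
    (h : IsCoker f g) : IsCoker (m ≫ f) g :=
  ⟨by rw [Category.assoc, h.zero, comp_zero], h.epi, fun T t ht => h.desc t (by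
    rw [← cancel_epi m, ← Category.assoc, ht, comp_zero])⟩

theorem WeaklyIdempotentComplete.exists_splitting (hC : WeaklyIdempotentComplete C) {X N : C}
    (r : X ⟶ N) (s : N ⟶ X) (hs : s ≫ r = 𝟙 N) :
    ∃ (K : C) (ι : K ⟶ X) (π : X ⟶ K), ι ≫ π = 𝟙 K ∧ ι ≫ r = 0 ∧ π ≫ ι = 𝟙 X - r ≫ s := by
  obtain ⟨K, ι, h⟩ := hasKernel_iff.1 (hC r s hs)
  obtain ⟨π, hπ⟩ := h.lift (𝟙 X - r ≫ s) (by simp [hs])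
  have := h.mono
  exact ⟨K, ι, π, by simp [← cancel_mono ι, hπ, reassoc_of% h.zero], h.zero, hπ⟩

section PullbackKernel

theorem IsKer.of_isPullback {P Y Z W K : C} {a : P ⟶ Y} {b : P ⟶ Z} {g : Y ⟶ W} {h : Z ⟶ W}
    (sq : IsPullback a b g h) {k : K ⟶ Y} (hk : IsKer k g) :
    ∃ k' : K ⟶ P, k' ≫ a = k ∧ IsKer k' b := by
  have := hk.mono
  have ha : sq.lift k 0 (by simp [hk.zero]) ≫ a = k := sq.lift_fst _ _ _
  refine ⟨sq.lift k 0 (by simp [hk.zero]), ha, sq.lift_snd _ _ _,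
    ?_, fun T t ht => ?_⟩
  · rw [← ha] at this
    exact mono_of_mono _ a
  · obtain ⟨l, hl⟩ := hk.lift (t ≫ a) (by rw [Category.assoc, sq.w, reassoc_of% ht, zero_comp])
    exact ⟨l, sq.hom_ext (by simp [hl]) (by simp [ht])⟩

/-- The kernel of a composite is the preimage of the kernel of the second map, so kernels of
composites reduce to pullbacks. -/
theorem IsKer.comp_of_isPullback {X Y Z K P : C} {f : X ⟶ Y} {g : Y ⟶ Z} {k : K ⟶ Y}
    (hk : IsKer k g) {a : P ⟶ X} {b : P ⟶ K} (sq : IsPullback a b f k) : IsKer a (f ≫ g) := by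
  have := hk.mono
  refine ⟨by rw [reassoc_of% sq.w, hk.zero, comp_zero], ⟨fun x y hxy => sq.hom_ext hxy ?_⟩,
    fun T t ht => ?_⟩
  · rw [← cancel_mono k, Category.assoc, Category.assoc, ← sq.w, reassoc_of% hxy]
  · obtain ⟨l, hl⟩ := hk.lift (t ≫ f) (by rw [Category.assoc, ht])
    exact ⟨sq.lift t l hl.symm, sq.lift_fst _ _ _⟩

end PullbackKernel

end KernelPairs

/-! ### Deflations and the effect of R0*. -/

section Deflations

variable {C : Type u} [Category.{v} C] [Preadditive C]

namespace ConflationStructure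

variable (e : ConflationStructure C)

theorem isKer {S : ShortComplex C} (h : e.conflation S) : IsKer S.f S.g :=
  (isKer_iff S.zero).2 (e.isKernel S h)

theorem isCoker {S : ShortComplex C} (h : e.conflation S) : IsCoker S.f S.g :=
  (isCoker_iff S.zero).2 (e.isCokernel S h)

variable {e}

theorem IsDeflation.hasKernel {Y Z : C} {g : Y ⟶ Z} (h : e.IsDeflation g) : HasKernel g := by
  obtain ⟨X, f, w, hf⟩ := h
  exact hasKernel_iff.2 ⟨X, f, e.isKer hf⟩

theorem IsDeflation.epi {Y Z : C} {g : Y ⟶ Z} (h : e.IsDeflation g) : Epi g := by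
  obtain ⟨X, f, w, hf⟩ := h
  exact (e.isCoker hf).epi

theorem IsInflation.mono {Y Z : C} {g : Y ⟶ Z} (h : e.IsInflation g) : Mono g := by
  obtain ⟨X, f, w, hf⟩ := h
  exact (e.isKer hf).mono

theorem IsDeflation.conflation {X Y Z : C} {f : X ⟶ Y} {g : Y ⟶ Z} (h : e.IsDeflation g)
    (hf : IsKer f g) : e.conflation (ShortComplex.mk f g hf.zero) := by
  obtain ⟨X', f', w, h⟩ := h
  obtain ⟨φ, hφ⟩ := (e.isKer h).exists_iso hf
  exact e.of_iso (ShortComplex.isoMk φ (Iso.refl _) (Iso.refl _) (by simpa using hφ) (by simp)) h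

theorem IsDeflation.of_iso {Y Z Y' Z' : C} {g : Y ⟶ Z} {g' : Y' ⟶ Z'} (h : e.IsDeflation g)
    (a : Y ≅ Y') (b : Z ≅ Z') (w : a.hom ≫ g' = g ≫ b.hom) : e.IsDeflation g' := by
  obtain ⟨X, f, w', h⟩ := h
  have w'' : (f ≫ a.hom) ≫ g' = 0 := by rw [Category.assoc, w, reassoc_of% w', zero_comp]
  exact ⟨X, f ≫ a.hom, w'', e.of_iso (ShortComplex.isoMk (S₁ := ShortComplex.mk f g w')
    (S₂ := ShortComplex.mk _ g' w'') (Iso.refl _) a b) h⟩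

end ConflationStructure

open ConflationStructure

namespace RightExactStructure

variable {e : RightExactStructure C}

theorem isDeflation_of_isPullback {P Y Z W : C} {a : P ⟶ Y} {b : P ⟶ Z} {g : Y ⟶ W} {h : Z ⟶ W}
    (sq : IsPullback a b g h) (hg : e.IsDeflation g) : e.IsDeflation b := by
  obtain ⟨P', a', b', sq', hb⟩ := e.r2 g h hg
  exact hb.of_iso (sq'.isoIsPullback _ _ sq) (Iso.refl _) (by simp)

theorem isPullback_biprod_map [HasBinaryBiproducts C] (X : C) {V W : C} (q : V ⟶ W) :
    IsPullback biprod.snd (biprod.map (𝟙 X) q) q biprod.snd :=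
  ⟨⟨by simp⟩, ⟨PullbackCone.IsLimit.mk _ (fun s => biprod.lift (s.snd ≫ biprod.fst) s.fst)
    (fun s => by simp) (fun s => by
      have := s.condition
      ext <;> simp [this])
    (fun s m h₁ h₂ => by
      ext
      · simp [← h₂]
      · simp [← h₁])⟩⟩

variable [HasZeroObject C] [HasBinaryBiproducts C]

/-- The projection is a pullback of X ⟶ 0; this is where R0* enters. -/
theorem isDeflation_biprod_snd (h₀ : e.R0Star) (X Y : C) :
    e.IsDeflation (biprod.snd : X ⊞ Y ⟶ Y) :=
  isDeflation_of_isPullback (IsPullback.of_has_biproduct X Y)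
    (h₀ _ (isZero_zero C))

/-- A shear automorphism of X ⊞ Y turns the projection to Y into the row (f, 1). -/
theorem isDeflation_biprod_desc_id (h₀ : e.R0Star) {X Y : C} (f : X ⟶ Y) :
    e.IsDeflation (biprod.desc f (𝟙 Y)) :=
  (isDeflation_biprod_snd h₀ X Y).of_iso (Biprod.unipotentUpper (-f)) (Iso.refl _) (by
    ext <;> simp [Biprod.ofComponents])

/-- The row factors as 1 ⊞ q, a pullback of q, followed by (f, 1). -/
theorem isDeflation_biprod_desc (h₀ : e.R0Star) {X V W : C} (f : X ⟶ W) {q : V ⟶ W}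
    (hq : e.IsDeflation q) : e.IsDeflation (biprod.desc f q) := by
  have : biprod.desc f q = biprod.map (𝟙 X) q ≫ biprod.desc f (𝟙 W) := by ext <;> simp
  rw [this]
  exact e.r1 _ _ (isDeflation_of_isPullback (isPullback_biprod_map X q) hq)
    (isDeflation_biprod_desc_id h₀ f)

end RightExactStructure

end Deflations

section Completion

variable {C : Type u} [Category.{v} C] [Preadditive C]
  {D : Type u₂} [Category.{v₂} D] [Preadditive D]

/-! ### Full embeddings in which every object is a retract of an image object. -/

section Dense

variable {j : C ⥤ D} [j.Full] [j.Faithful] [j.Additive]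
  (hj : ∀ X : D, ∃ B : C, Nonempty (Retract X (j.obj B)))

include hj

theorem map_hom_ext {Y : D} {T : D} {s t : T ⟶ Y}
    (h : ∀ (B : C) (r : j.obj B ⟶ T), r ≫ s = r ≫ t) : s = t := by
  obtain ⟨B, ⟨R⟩⟩ := hj T
  have := h B R.r
  simpa using R.i ≫= this

theorem mono_map {X Y : C} (f : X ⟶ Y) [Mono f] : Mono (j.map f) where
  right_cancellation {T} s t hst := by
    refine map_hom_ext hj fun B r => ?_
    obtain ⟨a, ha⟩ := j.map_surjective (r ≫ s)
    obtain ⟨b, hb⟩ := j.map_surjective (r ≫ t)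
    have : j.map (a ≫ f) = j.map (b ≫ f) := by simp [ha, hb, hst]
    rw [← ha, ← hb, (cancel_mono f).1 (j.map_injective this)]

theorem epi_map {X Y : C} (f : X ⟶ Y) [Epi f] : Epi (j.map f) where
  left_cancellation {T} s t hst := by
    obtain ⟨B, ⟨R⟩⟩ := hj T
    obtain ⟨a, ha⟩ := j.map_surjective (s ≫ R.i)
    obtain ⟨b, hb⟩ := j.map_surjective (t ≫ R.i)
    have : j.map (f ≫ a) = j.map (f ≫ b) := by simp [ha, hb, reassoc_of% hst]
    have h := (cancel_epi f).1 (j.map_injective this)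
    have : s ≫ R.i = t ≫ R.i := by rw [← ha, ← hb, h]
    simpa using this =≫ R.r

/-- A test object is a retract of an image object, and there fullness moves the lifting problem back
to the source category. -/
theorem IsKer.map {X Y Z : C} {f : X ⟶ Y} {g : Y ⟶ Z} (h : IsKer f g) :
    IsKer (j.map f) (j.map g) := by
  have := h.mono
  refine ⟨by rw [← j.map_comp, h.zero, j.map_zero], mono_map hj f, fun T t ht => ?_⟩
  obtain ⟨B, ⟨R⟩⟩ := hj T
  obtain ⟨a, ha⟩ := j.map_surjective (R.r ≫ t)
  obtain ⟨l, hl⟩ := h.lift a (j.map_injective (by simp [ha, ht]))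
  exact ⟨R.i ≫ j.map l, by rw [Category.assoc, ← j.map_comp, hl, ha, R.retract_assoc]⟩

theorem IsCoker.map {X Y Z : C} {f : X ⟶ Y} {g : Y ⟶ Z} (h : IsCoker f g) :
    IsCoker (j.map f) (j.map g) := by
  have := h.epi
  refine ⟨by rw [← j.map_comp, h.zero, j.map_zero], epi_map hj g, fun T t ht => ?_⟩
  obtain ⟨B, ⟨R⟩⟩ := hj T
  obtain ⟨a, ha⟩ := j.map_surjective (t ≫ R.i)
  obtain ⟨l, hl⟩ := h.desc a (j.map_injective (by simp [ha, reassoc_of% ht]))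
  exact ⟨j.map l ≫ R.r, by rw [← Category.assoc, ← j.map_comp, hl, ha, Category.assoc, R.retract,
    Category.comp_id]⟩

/-- Together with `hom_ext_map_of_isPullback`, this says that `j` preserves pullbacks. -/
theorem exists_lift_map_of_isPullback {P X Y Z : C} {a : P ⟶ X} {b : P ⟶ Y} {f : X ⟶ Z}
    {g : Y ⟶ Z} (sq : IsPullback a b f g) {T : D} (s : T ⟶ j.obj X) (t : T ⟶ j.obj Y)
    (hst : s ≫ j.map f = t ≫ j.map g) :
    ∃ l : T ⟶ j.obj P, l ≫ j.map a = s ∧ l ≫ j.map b = t := by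
  obtain ⟨B, ⟨R⟩⟩ := hj T
  obtain ⟨s', hs⟩ := j.map_surjective (R.r ≫ s)
  obtain ⟨t', ht⟩ := j.map_surjective (R.r ≫ t)
  have w : s' ≫ f = t' ≫ g := j.map_injective (by simp [hs, ht, hst])
  exact ⟨R.i ≫ j.map (sq.lift s' t' w),
    by rw [Category.assoc, ← j.map_comp, sq.lift_fst, hs, R.retract_assoc],
    by rw [Category.assoc, ← j.map_comp, sq.lift_snd, ht, R.retract_assoc]⟩

theorem hom_ext_map_of_isPullback {P X Y Z : C} {a : P ⟶ X} {b : P ⟶ Y} {f : X ⟶ Z}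
    {g : Y ⟶ Z} (sq : IsPullback a b f g) {T : D} {s t : T ⟶ j.obj P}
    (h₁ : s ≫ j.map a = t ≫ j.map a) (h₂ : s ≫ j.map b = t ≫ j.map b) : s = t := by
  refine map_hom_ext hj fun B r => ?_
  obtain ⟨s', hs⟩ := j.map_surjective (r ≫ s)
  obtain ⟨t', ht⟩ := j.map_surjective (r ≫ t)
  rw [← hs, ← ht]
  congr 1
  refine sq.hom_ext (j.map_injective ?_) (j.map_injective ?_)
  · simp [hs, ht, h₁]
  · simp [hs, ht, h₂]

end Dense

/-! ### Retracts of conflations and the lifting criterion. -/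

/-- The sequences that are retracts of images of conflations. -/
def retractConflation (e : RightExactStructure C) (j : C ⥤ D) [j.Additive] :
    ObjectProperty (ShortComplex D) :=
  fun S => ∃ T : ShortComplex C, e.conflation T ∧ Nonempty (Retract S (T.map j))

theorem retractConflation_iff {e : RightExactStructure C} {j : C ⥤ D} [j.Additive]
    {X Y Z : D} {f : X ⟶ Y} {g : Y ⟶ Z} (zero : f ≫ g = 0) :
    retractConflation e j (ShortComplex.mk f g zero) ↔
      ∃ (X' Y' Z' : C) (f' : X' ⟶ Y') (g' : Y' ⟶ Z') (zero' : f' ≫ g' = 0)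
        (i₁ : X ⟶ j.obj X') (r₁ : j.obj X' ⟶ X) (i₂ : Y ⟶ j.obj Y') (r₂ : j.obj Y' ⟶ Y)
        (i₃ : Z ⟶ j.obj Z') (r₃ : j.obj Z' ⟶ Z), e.conflation (ShortComplex.mk f' g' zero') ∧
        i₁ ≫ r₁ = 𝟙 X ∧ i₂ ≫ r₂ = 𝟙 Y ∧ i₃ ≫ r₃ = 𝟙 Z ∧
        i₁ ≫ j.map f' = f ≫ i₂ ∧ i₂ ≫ j.map g' = g ≫ i₃ ∧
        r₁ ≫ f = j.map f' ≫ r₂ ∧ r₂ ≫ g = j.map g' ≫ r₃ := by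
  constructor
  · rintro ⟨T, hT, ⟨R⟩⟩
    exact ⟨_, _, _, T.f, T.g, T.zero, R.i.τ₁, R.r.τ₁, R.i.τ₂, R.r.τ₂, R.i.τ₃, R.r.τ₃, hT,
      congrArg ShortComplex.Hom.τ₁ R.retract,
      congrArg ShortComplex.Hom.τ₂ R.retract,
      congrArg ShortComplex.Hom.τ₃ R.retract,
      R.i.comm₁₂, R.i.comm₂₃, R.r.comm₁₂, R.r.comm₂₃⟩
  · rintro ⟨X', Y', Z', f', g', zero', i₁, r₁, i₂, r₂, i₃, r₃, hT, h₁, h₂, h₃, hi, hi', hr, hr'⟩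
    exact ⟨_, hT, ⟨⟨⟨i₁, i₂, i₃, hi, hi'⟩, ⟨r₁, r₂, r₃, hr, hr'⟩,
      ShortComplex.hom_ext _ _ h₁ h₂ h₃⟩⟩⟩

/-- Each morphism from an image object to the target of `p` lifts along `p` after composition with
a deflation. -/
def LiftsDeflations (e : RightExactStructure C) (j : C ⥤ D) {Y Z : D} (p : Y ⟶ Z) : Prop :=
  ∀ ⦃W : C⦄ (h : j.obj W ⟶ Z), ∃ (V : C) (q : V ⟶ W) (v : j.obj V ⟶ Y),
    e.IsDeflation q ∧ v ≫ p = j.map q ≫ h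

namespace LiftsDeflations

variable {e : RightExactStructure C} {j : C ⥤ D}

theorem comp {X Y Z : D} {f : X ⟶ Y} {g : Y ⟶ Z} (hf : LiftsDeflations e j f)
    (hg : LiftsDeflations e j g) : LiftsDeflations e j (f ≫ g) := by
  intro W h
  obtain ⟨V, q, v, hq, w⟩ := hg h
  obtain ⟨V', q', v', hq', w'⟩ := hf v
  exact ⟨V', q' ≫ q, v', e.r1 _ _ hq' hq, by rw [reassoc_of% w', w, j.map_comp, Category.assoc]⟩

theorem of_comp {X Y Z : D} {f : X ⟶ Y} {g : Y ⟶ Z} (h : LiftsDeflations e j (f ≫ g)) :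
    LiftsDeflations e j g := by
  intro W t
  obtain ⟨V, q, v, hq, w⟩ := h t
  exact ⟨V, q, v ≫ f, hq, by rw [← w, Category.assoc]⟩

theorem of_isPullback {P Y Z W : D} {a : P ⟶ Y} {b : P ⟶ Z} {g : Y ⟶ W} {h : Z ⟶ W}
    (sq : IsPullback a b g h) (hg : LiftsDeflations e j g) : LiftsDeflations e j b := by
  intro T t
  obtain ⟨V, q, v, hq, w⟩ := hg (t ≫ h)
  exact ⟨V, q, sq.lift v (j.map q ≫ t) (by simpa using w), hq, sq.lift_snd _ _ _⟩

end LiftsDeflations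

section

variable {e : RightExactStructure C} {j : C ⥤ D} [j.Full] [j.Faithful] [j.Additive]

/-- The ambient deflation is pulled back in the source category along the map to Z' induced by h;
retracting to Y gives the lift. -/
theorem liftsDeflations_of_retractConflation {X Y Z : D} {f : X ⟶ Y} {g : Y ⟶ Z}
    {zero : f ≫ g = 0} (hS : retractConflation e j (ShortComplex.mk f g zero)) :
    LiftsDeflations e j g := by
  obtain ⟨X', Y', Z', f', g', zero', i₁, r₁, i₂, r₂, i₃, r₃, hT, h₁, h₂, h₃, hi, hi', hr, hr'⟩ :=
    (retractConflation_iff zero).1 hS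
  intro W h
  obtain ⟨h', hh'⟩ := j.map_surjective (h ≫ i₃)
  obtain ⟨V, a, q, sq, hq⟩ := e.r2 g' h' ⟨_, _, _, hT⟩
  refine ⟨V, q, j.map a ≫ r₂, hq, ?_⟩
  have := j.congr_map sq.w
  simp only [j.map_comp, hh'] at this
  rw [Category.assoc, hr', reassoc_of% this, h₃, Category.comp_id]

theorem isKer_of_retractConflation (hj : ∀ X : D, ∃ B : C, Nonempty (Retract X (j.obj B)))
    {S : ShortComplex D} (hS : retractConflation e j S) : IsKer S.f S.g := by
  obtain ⟨T, hT, ⟨R⟩⟩ := hS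
  exact IsKer.of_retract R ((e.isKer hT).map hj)

theorem isCoker_of_retractConflation (hj : ∀ X : D, ∃ B : C, Nonempty (Retract X (j.obj B)))
    {S : ShortComplex D} (hS : retractConflation e j S) : IsCoker S.f S.g := by
  obtain ⟨T, hT, ⟨R⟩⟩ := hS
  exact IsCoker.of_retract R ((e.isCoker hT).map hj)

variable [HasZeroObject C] [HasBinaryBiproducts C]

/-- Z is a retract of jW and Y of jU, but the induced map U ⟶ W need not be a deflation. Adding a
deflation q over which the retraction jW ⟶ Z lifts turns it into the deflation (p', q), of which g
is still a retract. -/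
theorem retractConflation_of_liftsDeflations (h₀ : e.R0Star)
    (hj : ∀ X : D, ∃ B : C, Nonempty (Retract X (j.obj B)))
    {X Y Z : D} {f : X ⟶ Y} {g : Y ⟶ Z} (hS : IsKer f g) (hp : LiftsDeflations e j g) :
    retractConflation e j (ShortComplex.mk f g hS.zero) := by
  obtain ⟨W, ⟨RZ⟩⟩ := hj Z
  obtain ⟨U, ⟨RY⟩⟩ := hj Y
  obtain ⟨V, q, v, hq, w⟩ := hp RZ.r
  obtain ⟨p', hp'⟩ := j.map_surjective (RY.r ≫ g ≫ RZ.i)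
  obtain ⟨N, n, zero, hN⟩ := RightExactStructure.isDeflation_biprod_desc h₀ p' hq
  have hn : IsKer (j.map n) _ := (e.isKer hN).map hj
  have := hn.mono
  have := hS.mono
  -- The inclusion of Y uses the summand U only; the retraction must use v on V to be compatible
  -- with g.
  let r₂ : j.obj (U ⊞ V) ⟶ Y := j.map biprod.fst ≫ RY.r + j.map biprod.snd ≫ v
  have hr₂ : r₂ ≫ g = j.map (biprod.desc p' q) ≫ RZ.r := by
    have : biprod.desc p' q = biprod.fst ≫ p' + biprod.snd ≫ q := by ext <;> simp
    simp [r₂, this, hp', w]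
  let i₂ : Y ⟶ j.obj (U ⊞ V) := RY.i ≫ j.map biprod.inl
  have hi₂ : i₂ ≫ j.map (biprod.desc p' q) = g ≫ RZ.i := by
    simp only [i₂, Category.assoc, ← j.map_comp, biprod.inl_desc, hp', RY.retract_assoc]
  have hir : i₂ ≫ r₂ = 𝟙 _ := by
    simp only [i₂, r₂, Preadditive.comp_add, Category.assoc, ← j.map_comp_assoc]
    simp
  obtain ⟨i₁, hi₁⟩ := hn.lift (f ≫ i₂) (by
    dsimp only
    rw [Category.assoc, hi₂, reassoc_of% hS.zero, zero_comp])
  obtain ⟨r₁, hr₁⟩ := hS.lift (j.map n ≫ r₂) (by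
    rw [Category.assoc, hr₂, reassoc_of% hn.zero, zero_comp])
  refine (retractConflation_iff _).2 ⟨N, U ⊞ V, W, n, biprod.desc p' q, zero, i₁, r₁, i₂, r₂, RZ.i,
    RZ.r, hN, ?_, hir, RZ.retract, hi₁, hi₂, hr₁, hr₂⟩
  rw [← cancel_mono f, Category.assoc, hr₁, reassoc_of% hi₁, hir, Category.comp_id,
    Category.id_comp]

end

/-! ### Existence of pullbacks in the completion. -/

section Pullbacks

variable {e : RightExactStructure C} {j : C ⥤ D} [j.Full] [j.Faithful] [j.Additive]
  [HasZeroObject C] [HasBinaryBiproducts C] [HasBinaryBiproducts D]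

theorem exists_retract_of_exists_complement
    (hj : ∀ X : D, ∃ A B : C, Nonempty (X ⊞ j.obj A ≅ j.obj B)) (X : D) :
    ∃ B : C, Nonempty (Retract X (j.obj B)) := by
  obtain ⟨A, B, ⟨φ⟩⟩ := hj X
  exact ⟨B, ⟨⟨biprod.inl ≫ φ.hom, φ.inv ≫ biprod.fst, by simp⟩⟩⟩

/-- The solutions of an equation whose last summand is a deflation form an object. -/
theorem exists_solution_object (h₀ : e.R0Star)
    (hj : ∀ X : D, ∃ B : C, Nonempty (Retract X (j.obj B))) {U W V Z X : C}
    (f : j.obj U ⟶ j.obj X) (p : j.obj W ⟶ j.obj X) {q : V ⟶ X} (hq : e.IsDeflation q)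
    (h : j.obj Z ⟶ j.obj X) :
    ∃ (Q : D) (α : Q ⟶ j.obj U) (ω : Q ⟶ j.obj W) (ν : Q ⟶ j.obj V) (ζ : Q ⟶ j.obj Z),
      α ≫ f + ω ≫ p + ν ≫ j.map q = ζ ≫ h ∧
      (∀ ⦃T : D⦄ (a : T ⟶ j.obj U) (b : T ⟶ j.obj W) (c : T ⟶ j.obj V) (d : T ⟶ j.obj Z),
        a ≫ f + b ≫ p + c ≫ j.map q = d ≫ h →
          ∃ l : T ⟶ Q, l ≫ α = a ∧ l ≫ ω = b ∧ l ≫ ν = c ∧ l ≫ ζ = d) ∧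
      (∀ ⦃T : D⦄ (l m : T ⟶ Q), l ≫ α = m ≫ α → l ≫ ω = m ≫ ω → l ≫ ν = m ≫ ν →
        l ≫ ζ = m ≫ ζ → l = m) := by
  obtain ⟨f, rfl⟩ := j.map_surjective f
  obtain ⟨p, rfl⟩ := j.map_surjective p
  obtain ⟨h, rfl⟩ := j.map_surjective h
  -- Since q is a deflation, so is the row ((f, p), q), and the solutions form its pullback along h.
  obtain ⟨Q, a, b, sq, -⟩ := e.r2 _ h
    (RightExactStructure.isDeflation_biprod_desc h₀ (biprod.desc f p) hq)
  have key : biprod.desc (biprod.desc f p) q =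
    biprod.fst ≫ biprod.fst ≫ f + biprod.fst ≫ biprod.snd ≫ p + biprod.snd ≫ q := by
    ext <;> simp
  refine ⟨j.obj Q, j.map (a ≫ biprod.fst ≫ biprod.fst), j.map (a ≫ biprod.fst ≫ biprod.snd),
    j.map (a ≫ biprod.snd), j.map b, ?_, fun T x y z t h => ?_, fun T l m h₁ h₂ h₃ h₄ => ?_⟩
  · rw [← j.map_comp b, ← sq.w, key]
    simp
  · obtain ⟨l, hl₁, hl₂⟩ := exists_lift_map_of_isPullback hj sq
      ((x ≫ j.map biprod.inl + y ≫ j.map biprod.inr) ≫ j.map biprod.inl + z ≫ j.map biprod.inr) t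
      (by
        simp only [← h, Preadditive.add_comp, Category.assoc, ← j.map_comp]
        simp)
    refine ⟨l, ?_, ?_, ?_, hl₂⟩
    all_goals
      rw [j.map_comp, reassoc_of% hl₁]
      simp only [Preadditive.add_comp, Category.assoc, ← j.map_comp]
      simp
  · have id₁ : 𝟙 ((U ⊞ W) ⊞ V) = biprod.fst ≫ biprod.fst ≫ biprod.inl ≫ biprod.inl +
      biprod.fst ≫ biprod.snd ≫ biprod.inr ≫ biprod.inl + biprod.snd ≫ biprod.inr := by
      ext <;> simp
    refine hom_ext_map_of_isPullback hj sq ?_ h₄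
    rw [← Category.comp_id a, id₁]
    simp only [j.map_comp] at h₁ h₂ h₃
    simp [reassoc_of% h₁, reassoc_of% h₂, reassoc_of% h₃]

/-- With W a retract of jW₁, the equation g(y) = h(z) is padded to one over image objects, whose
solution object Q exists. The variable ν makes the row a deflation, and ω absorbs the part of q(ν)
lying outside W. Solutions of the padded equation are pairs in the pullback together with free
parameters in jA, jV, jA' and W, so the pullback is the kernel of a retraction of Q. -/
theorem LiftsDeflations.exists_isPullback (h₀ : e.R0Star) (hD : WeaklyIdempotentComplete D)
    (hj : ∀ X : D, ∃ A B : C, Nonempty (X ⊞ j.obj A ≅ j.obj B))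
    {Y Z W : D} {g : Y ⟶ W} (hg : LiftsDeflations e j g) (h : Z ⟶ W) :
    ∃ (P : D) (a : P ⟶ Y) (b : P ⟶ Z), IsPullback a b g h := by
  have hj' := exists_retract_of_exists_complement hj
  obtain ⟨A, U, ⟨φ⟩⟩ := hj Y
  obtain ⟨A', Z₁, ⟨ψ⟩⟩ := hj Z
  obtain ⟨W₁, ⟨s, r, hsr⟩⟩ := hj' W
  obtain ⟨V, q, v, hq, w⟩ := hg r
  obtain ⟨Q, α, ω, ν, ζ, rel, exi, uni⟩ := exists_solution_object h₀ hj'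
    (φ.inv ≫ biprod.fst ≫ g ≫ s) (𝟙 _ - r ≫ s) hq (ψ.inv ≫ biprod.fst ≫ h ≫ s)
  have rel' : α ≫ φ.inv ≫ biprod.fst ≫ g + ν ≫ v ≫ g = ζ ≫ ψ.inv ≫ biprod.fst ≫ h := by
    have := rel =≫ r
    simpa [hsr, w] using this
  -- The section inserts the free parameters: on jV the terms -v and -(1 - rs)q cancel the two
  -- components of q, while W enters ω through s.
  obtain ⟨σ, σ₁, σ₂, σ₃, σ₄⟩ := exi (T := (j.obj A ⊞ j.obj V) ⊞ (j.obj A' ⊞ W))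
    (biprod.desc (biprod.desc (biprod.inr ≫ φ.hom) (-v ≫ biprod.inl ≫ φ.hom)) 0)
    (biprod.desc (biprod.desc 0 (-j.map q ≫ (𝟙 _ - r ≫ s))) (biprod.desc 0 s))
    (biprod.desc (biprod.desc 0 (𝟙 _)) 0)
    (biprod.desc 0 (biprod.desc (biprod.inr ≫ ψ.hom) 0)) (by
      ext <;> simp [reassoc_of% hsr, reassoc_of% w]
      abel)
  obtain ⟨K, ι, π, hιπ, hι, hπ⟩ := hD.exists_splitting
    (biprod.lift (biprod.lift (α ≫ φ.inv ≫ biprod.snd) ν)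
      (biprod.lift (ζ ≫ ψ.inv ≫ biprod.snd) (ω ≫ r))) σ (by
      ext <;> simp [reassoc_of% σ₁, reassoc_of% σ₂, reassoc_of% σ₄, σ₃, hsr])
  have ι₁ : ι ≫ α ≫ φ.inv ≫ biprod.snd = 0 := by
    simpa using hι =≫ (biprod.fst ≫ biprod.fst)
  have ι₂ : ι ≫ ν = 0 := by
    simpa using hι =≫ (biprod.fst ≫ biprod.snd)
  have ι₃ : ι ≫ ζ ≫ ψ.inv ≫ biprod.snd = 0 := by
    simpa using hι =≫ (biprod.snd ≫ biprod.fst)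
  have ι₄ : ι ≫ ω ≫ r = 0 := by
    simpa using hι =≫ (biprod.snd ≫ biprod.snd)
  have hα : (ι ≫ α ≫ φ.inv ≫ biprod.fst) ≫ biprod.inl ≫ φ.hom = ι ≫ α := by
    rw [← cancel_mono φ.inv]
    ext <;> simp [ι₁]
  have hζ : (ι ≫ ζ ≫ ψ.inv ≫ biprod.fst) ≫ biprod.inl ≫ ψ.hom = ι ≫ ζ := by
    rw [← cancel_mono ψ.inv]
    ext <;> simp [ι₃]
  -- On the kernel, where ν and the W-component of ω vanish, the padded equation determines ω from
  -- the other coordinates.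
  have hω : ι ≫ ω = (ι ≫ ζ) ≫ ψ.inv ≫ biprod.fst ≫ h ≫ s - (ι ≫ α) ≫ φ.inv ≫ biprod.fst ≫ g ≫ s := by
    have := ι ≫= rel
    simp only [Preadditive.comp_add, reassoc_of% ι₂, zero_comp, add_zero, Preadditive.comp_sub,
      Category.comp_id, reassoc_of% ι₄, sub_zero] at this
    simp [← this]
  have : Mono ι := (SplitMono.mk π hιπ).mono
  refine ⟨K, ι ≫ α ≫ φ.inv ≫ biprod.fst, ι ≫ ζ ≫ ψ.inv ≫ biprod.fst, ⟨?_⟩, ⟨?_⟩⟩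
  · simp [← rel', reassoc_of% ι₂]
  · have ex (c : PullbackCone g h) : ∃ l : c.pt ⟶ K, l ≫ ι ≫ α ≫ φ.inv ≫ biprod.fst = c.fst ∧
        l ≫ ι ≫ ζ ≫ ψ.inv ≫ biprod.fst = c.snd := by
      have hc := c.condition
      obtain ⟨l, l₁, l₂, l₃, l₄⟩ := exi (c.fst ≫ biprod.inl ≫ φ.hom) 0 0
        (c.snd ≫ biprod.inl ≫ ψ.hom) (by simp [reassoc_of% hc])
      -- All free parameters of this solution are zero, so it factors through the kernel.
      have : l ≫ π ≫ ι = l := by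
        rw [hπ, Preadditive.comp_sub, Category.comp_id, sub_eq_self, ← Category.assoc]
        convert zero_comp
        ext <;> simp [reassoc_of% l₁, reassoc_of% l₂, l₃, reassoc_of% l₄]
      refine ⟨l ≫ π, ?_, ?_⟩
      · rw [Category.assoc, reassoc_of% this, reassoc_of% l₁]
        simp
      · rw [Category.assoc, reassoc_of% this, reassoc_of% l₄]
        simp
    refine PullbackCone.IsLimit.mk _ (fun c => (ex c).choose) (fun c => (ex c).choose_spec.1)
      (fun c => (ex c).choose_spec.2) (fun c m h₁ h₂ => ?_)
    obtain ⟨e₁, e₂⟩ := (ex c).choose_spec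
    generalize (ex c).choose = l at e₁ e₂
    have f₁ : m ≫ ι ≫ α = l ≫ ι ≫ α := by
      rw [← hα, ← Category.assoc m, h₁, ← Category.assoc l, e₁]
    have f₂ : m ≫ ι ≫ ζ = l ≫ ι ≫ ζ := by
      rw [← hζ, ← Category.assoc m, h₂, ← Category.assoc l, e₂]
    rw [← cancel_mono ι]
    refine uni _ _ (by simpa using f₁) ?_ (by simp [ι₂]) (by simpa using f₂)
    rw [Category.assoc, Category.assoc, hω, Preadditive.comp_sub, Preadditive.comp_sub,
      ← Category.assoc m, f₂, ← Category.assoc m, f₁]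
    simp

end Pullbacks

end Completion

/-! ### The right exact structure on the completion. -/

section CompletedStructure

variable {C : Type u} [Category.{v} C] [Preadditive C] [HasZeroObject C] [HasBinaryBiproducts C]
  {D : Type u₂} [Category.{v₂} D] [Preadditive D] [HasBinaryBiproducts D]
  {e : RightExactStructure C} {j : C ⥤ D} [j.Full] [j.Faithful] [j.Additive]

variable (e j) in
/-- The retracts of images of conflations, as a conflation structure. -/
def retractConflationStructure (hj : ∀ X : D, ∃ B : C, Nonempty (Retract X (j.obj B))) :
    ConflationStructure D where
  conflation := retractConflation e j
  isKernel S hS := (isKer_iff S.zero).1 (isKer_of_retractConflation hj hS)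
  isCokernel S hS := (isCoker_iff S.zero).1 (isCoker_of_retractConflation hj hS)
  of_iso := by
    rintro S T φ ⟨U, hU, ⟨R⟩⟩
    exact ⟨U, hU, ⟨(Retract.ofIso φ.symm).trans R⟩⟩

theorem isDeflation_retractConflationStructure_iff (h₀ : e.R0Star)
    (hj : ∀ X : D, ∃ B : C, Nonempty (Retract X (j.obj B))) {Y Z : D} (g : Y ⟶ Z) :
    (retractConflationStructure e j hj).IsDeflation g ↔
      HasKernel g ∧ LiftsDeflations e j g := by
  constructor
  · intro h
    refine ⟨h.hasKernel, ?_⟩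
    obtain ⟨X, f, w, h⟩ := h
    exact liftsDeflations_of_retractConflation h
  · rintro ⟨h, h'⟩
    obtain ⟨X, f, hf⟩ := hasKernel_iff.1 h
    exact ⟨X, f, hf.zero, retractConflation_of_liftsDeflations h₀ hj hf h'⟩

variable (e j) in
/-- The right exact structure on a weak idempotent completion whose conflations are the retracts of
images of conflations. -/
def completedStructure (h₀ : e.R0Star) (hD : WeaklyIdempotentComplete D)
    (hj : ∀ X : D, ∃ A B : C, Nonempty (X ⊞ j.obj A ≅ j.obj B)) : RightExactStructure D where
  toConflationStructure := retractConflationStructure e j (exists_retract_of_exists_complement hj)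
  r0 Z hZ := by
    rw [isDeflation_retractConflationStructure_iff h₀]
    exact ⟨hasKernel_iff.2 ⟨Z, 0, by simp, ⟨fun _ _ _ => hZ.eq_of_tgt _ _⟩,
      fun T t _ => ⟨0, hZ.eq_of_tgt _ _⟩⟩, fun W h => ⟨W ⊞ W, biprod.snd, 0,
      RightExactStructure.isDeflation_biprod_snd h₀ W W, hZ.eq_of_tgt _ _⟩⟩
  r1 X Y Z f g := by
    rw [isDeflation_retractConflationStructure_iff h₀, isDeflation_retractConflationStructure_iff h₀,
      isDeflation_retractConflationStructure_iff h₀]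
    rintro ⟨-, hf⟩ ⟨hg, hg'⟩
    refine ⟨?_, hf.comp hg'⟩
    obtain ⟨K, k, hk⟩ := hasKernel_iff.1 hg
    -- Only the lifting property of f is used to pull back the kernel of g.
    obtain ⟨P, a, b, sq⟩ := hf.exists_isPullback h₀ hD hj k
    exact hasKernel_iff.2 ⟨P, a, hk.comp_of_isPullback sq⟩
  r2 Y Z W g h := by
    simp only [isDeflation_retractConflationStructure_iff h₀]
    rintro ⟨hg, hg'⟩
    obtain ⟨P, a, b, sq⟩ := hg'.exists_isPullback h₀ hD hj h
    obtain ⟨K, k, hk⟩ := hasKernel_iff.1 hg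
    obtain ⟨k', -, hk'⟩ := hk.of_isPullback sq
    exact ⟨P, a, b, sq, hasKernel_iff.2 ⟨K, k', hk'⟩, hg'.of_isPullback sq⟩

variable (h₀ : e.R0Star) (hD : WeaklyIdempotentComplete D)
  (hj : ∀ X : D, ∃ A B : C, Nonempty (X ⊞ j.obj A ≅ j.obj B))

theorem completedStructure_r3 : (completedStructure e j h₀ hD hj).R3 := by
  intro A B X i p hp h
  have hj' := exists_retract_of_exists_complement hj
  exact (isDeflation_retractConflationStructure_iff h₀ hj' p).2 ⟨hp,
    ((isDeflation_retractConflationStructure_iff h₀ hj' _).1 h).2.of_comp⟩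

theorem isExact_completedStructure : IsExact e (completedStructure e j h₀ hD hj) j :=
  ⟨inferInstance, fun S hS => ⟨S, hS, ⟨Retract.refl _⟩⟩⟩

end CompletedStructure

/-- The pullback of T.g along the inclusion S.X₃ ⟶ T.X₃ is a deflation, and it factors through S.g.
As S.g has a kernel, R3 applies. -/
theorem RightExactStructure.conflation_of_retract {C : Type u} [Category.{v} C] [Preadditive C]
    {e : RightExactStructure C} (h : e.R3) {S T : ShortComplex C} (R : Retract S T)
    (hT : e.conflation T) : e.conflation S := by
  have hS := (e.isKer hT).of_retract R
  obtain ⟨P, a, b, sq, hb⟩ := e.r2 T.g R.i.τ₃ ⟨_, _, _, hT⟩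
  refine ConflationStructure.IsDeflation.conflation (h (a ≫ R.r.τ₂) S.g (hasKernel_iff.2 ⟨_, _, hS⟩) ?_) hS
  have r₃ : R.i.τ₃ ≫ R.r.τ₃ = 𝟙 _ := by rw [← ShortComplex.comp_τ₃, R.retract]; rfl
  rwa [Category.assoc, R.r.comm₂₃, reassoc_of% sq.w, r₃, Category.comp_id]

/-! ### Extension of functors and natural transformations. -/

section Extension

variable {C : Type u} [Category.{v} C] [Preadditive C]
  {D : Type u₂} [Category.{v₂} D] [Preadditive D]
  {W : Type w} [Category.{w'} W] [Preadditive W]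
  (j : C ⥤ D) [j.Full] [j.Faithful] (F : C ⥤ W)

/-- A presentation of `X` as a retract of an object in the image of `j`, with a splitting of the
image under `F` of the corresponding idempotent. -/
structure ExtensionData (X : D) where
  /-- the ambient object -/
  B : C
  /-- the inclusion -/
  i : X ⟶ j.obj B
  /-- the projection -/
  p : j.obj B ⟶ X
  /-- the image of the split idempotent -/
  K : W
  /-- the inclusion of the image -/
  ι : K ⟶ F.obj B
  /-- the projection to the image -/
  π : F.obj B ⟶ K
  i_p : i ≫ p = 𝟙 X
  ι_π : ι ≫ π = 𝟙 K
  π_ι : π ≫ ι = F.map (j.preimage (p ≫ i))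

theorem ExtensionData.i_p_assoc {j : C ⥤ D} [j.Full] [j.Faithful] {F : C ⥤ W} {X : D} (d : ExtensionData j F X) {Z : D}
    (h : X ⟶ Z) : d.i ≫ d.p ≫ h = h := by
  rw [← Category.assoc, d.i_p, Category.id_comp]

theorem ExtensionData.π_ι_assoc {j : C ⥤ D} [j.Full] [j.Faithful] {F : C ⥤ W} {X : D}
    (d : ExtensionData j F X) {Z : W} (h : F.obj d.B ⟶ Z) :
    d.π ≫ d.ι ≫ h = F.map (j.preimage (d.p ≫ d.i)) ≫ h := by
  rw [← Category.assoc, d.π_ι]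

variable {j F}

/-- The idempotent of jB with image X is complementary to the one with image jA. The latter is split
already in the source category, so its image under F comes from a retraction, whose kernel exists in
the target. -/
theorem nonempty_extensionData [HasBinaryBiproducts D] [j.Additive] [F.Additive]
    (hW : WeaklyIdempotentComplete W)
    (hj : ∀ X : D, ∃ A B : C, Nonempty (X ⊞ j.obj A ≅ j.obj B)) (X : D) :
    Nonempty (ExtensionData j F X) := by
  obtain ⟨A, B, ⟨φ⟩⟩ := hj X
  obtain ⟨r, hr⟩ := j.map_surjective (φ.inv ≫ biprod.snd)
  obtain ⟨s, hs⟩ := j.map_surjective (biprod.inr ≫ φ.hom)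
  obtain ⟨K, ι, π, h₁, h₂, h₃⟩ := hW.exists_splitting (F.map r) (F.map s) (by
    rw [← F.map_comp, ← F.map_id]
    congr 1
    exact j.map_injective (by simp [hr, hs]))
  refine ⟨⟨B, biprod.inl ≫ φ.hom, φ.inv ≫ biprod.fst, K, ι, π, by simp, h₁, ?_⟩⟩
  rw [h₃, ← F.map_id, ← F.map_comp, ← F.map_sub]
  congr 1
  apply j.map_injective
  have : 𝟙 (X ⊞ j.obj A) = biprod.fst ≫ biprod.inl + biprod.snd ≫ biprod.inr := by ext <;> simp
  have := φ.inv ≫= this =≫ φ.hom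
  simp only [Category.id_comp, φ.inv_hom_id, Preadditive.add_comp, Preadditive.comp_add,
    Category.assoc] at this
  simp [hr, hs, this]

variable (d : ∀ X : D, ExtensionData j F X)

/-- The extension of a functor along a weak idempotent completion. -/
def extension : D ⥤ W where
  obj X := (d X).K
  map {X Y} f := (d X).ι ≫ F.map (j.preimage ((d X).p ≫ f ≫ (d Y).i)) ≫ (d Y).π
  map_id X := by
    rw [Category.id_comp, ← ExtensionData.π_ι_assoc, ExtensionData.ι_π, Category.comp_id,
      ExtensionData.ι_π]
  map_comp {X Y Z} f g := by
    simp only [Category.assoc, ExtensionData.π_ι_assoc]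
    simp only [← F.map_comp_assoc, ← j.preimage_comp]
    simp [ExtensionData.i_p_assoc]

/-- The inclusion of a value of the extension. -/
def extensionι (X : D) : (extension d).obj X ⟶ F.obj (d X).B := (d X).ι

/-- The projection to a value of the extension. -/
def extensionπ (X : D) : F.obj (d X).B ⟶ (extension d).obj X := (d X).π

theorem extensionι_extensionπ (X : D) : extensionι d X ≫ extensionπ d X = 𝟙 _ := (d X).ι_π

theorem extensionπ_extensionι_assoc (X : D) {Z : W} (h : F.obj (d X).B ⟶ Z) :
    extensionπ d X ≫ extensionι d X ≫ h = F.map (j.preimage ((d X).p ≫ (d X).i)) ≫ h :=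
  (d X).π_ι_assoc h

theorem extension_map {X Y : D} (f : X ⟶ Y) : (extension d).map f =
    extensionι d X ≫ F.map (j.preimage ((d X).p ≫ f ≫ (d Y).i)) ≫ extensionπ d Y := rfl

theorem extension_additive [j.Additive] [F.Additive] : (extension d).Additive where
  map_add {X Y f g} := by
    simp only [extension_map]
    rw [← Preadditive.comp_add, ← Preadditive.add_comp, ← F.map_add]
    congr 3
    exact j.map_injective (by simp)

/-- The value of the extension on an object in the image. -/
def extensionObjIso (B : C) : F.obj B ≅ (extension d).obj (j.obj B) where
  hom := F.map (j.preimage (d (j.obj B)).i) ≫ extensionπ d (j.obj B)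
  inv := extensionι d (j.obj B) ≫ F.map (j.preimage (d (j.obj B)).p)
  hom_inv_id := by
    simp only [Category.assoc, extensionπ_extensionι_assoc]
    simp only [← F.map_comp, ← j.preimage_comp]
    simp [ExtensionData.i_p]
  inv_hom_id := by
    simp only [Category.assoc, ← F.map_comp_assoc, ← j.preimage_comp]
    rw [← extensionπ_extensionι_assoc, extensionι_extensionπ, Category.comp_id,
      extensionι_extensionπ]

theorem extensionObjIso_naturality {B B' : C} (f : B ⟶ B') :
    F.map f ≫ (extensionObjIso d B').hom =
      (extensionObjIso d B).hom ≫ (extension d).map (j.map f) := by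
  simp only [extensionObjIso, extension_map, Category.assoc, extensionπ_extensionι_assoc]
  simp only [← F.map_comp_assoc]
  congr 2
  exact j.map_injective (by simp [ExtensionData.i_p_assoc])

/-- The extension of a functor restricts to the functor. -/
def extensionIso : F ≅ j ⋙ extension d :=
  NatIso.ofComponents (extensionObjIso d) (extensionObjIso_naturality d)

/-- The extension of a natural transformation. -/
def extensionHom {G : D ⥤ W} (γ : F ⟶ j ⋙ G) : extension d ⟶ G where
  app X := extensionι d X ≫ γ.app (d X).B ≫ G.map (d X).p
  naturality {X Y} f := by
    -- Composing the inclusion after the projection at Y leaves an idempotent behind, so naturality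
    -- is needed for the composite with it.
    have := γ.naturality (j.preimage ((d X).p ≫ f ≫ (d Y).i) ≫ j.preimage ((d Y).p ≫ (d Y).i))
    simp only [extension_map, Category.assoc, extensionπ_extensionι_assoc]
    rw [← F.map_comp_assoc, reassoc_of% this]
    simp only [j.map_comp, j.map_preimage, Category.assoc, ← G.map_comp,
      ExtensionData.i_p, ExtensionData.i_p_assoc, Category.comp_id]

theorem extensionIso_hom_extensionHom {G : D ⥤ W} (γ : F ⟶ j ⋙ G) :
    γ = (extensionIso d).hom ≫ Functor.whiskerLeft j (extensionHom d γ) := by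
  ext B
  have := γ.naturality (j.preimage (d (j.obj B)).i ≫
    j.preimage ((d (j.obj B)).p ≫ (d (j.obj B)).i))
  have h : (extensionObjIso d B).hom ≫ (extensionHom d γ).app (j.obj B) = γ.app B := by
    simp only [extensionObjIso, extensionHom, Category.assoc, extensionπ_extensionι_assoc]
    rw [← F.map_comp_assoc, reassoc_of% this]
    simp only [j.map_comp, j.map_preimage, Category.assoc, ← G.map_comp,
      ExtensionData.i_p, Category.comp_id, G.map_id]
  exact h.symm

theorem extension_hom_ext {G : D ⥤ W} {β β' : extension d ⟶ G}
    (h : Functor.whiskerLeft j β = Functor.whiskerLeft j β') : β = β' := by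
  ext X
  have h₁ : β.app (j.obj (d X).B) = β'.app (j.obj (d X).B) := NatTrans.congr_app h _
  have h₂ : G.map (d X).i ≫ G.map (d X).p = 𝟙 _ := by rw [← G.map_comp, (d X).i_p, G.map_id]
  rw [← Category.comp_id (β.app X), ← h₂, ← β.naturality_assoc, h₁, β'.naturality_assoc, h₂,
    Category.comp_id]

end Extension

theorem isTwoUniversal_completedStructure {C : Type u} [Category.{v} C] [Preadditive C]
    [HasZeroObject C] [HasBinaryBiproducts C] {D : Type u₂} [Category.{v₂} D] [Preadditive D]
    [HasBinaryBiproducts D] {e : RightExactStructure C} {j : C ⥤ D} [j.Full] [j.Faithful]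
    [j.Additive] (h₀ : e.R0Star) (hD : WeaklyIdempotentComplete D)
    (hj : ∀ X : D, ∃ A B : C, Nonempty (X ⊞ j.obj A ≅ j.obj B)) :
    IsTwoUniversal.{w', w} e (completedStructure e j h₀ hD hj) j := by
  intro W _ _ _ _ eW hW hW₃ F hF
  obtain ⟨_, hF⟩ := hF
  let d (X : D) : ExtensionData j F X := (nonempty_extensionData hW hj X).some
  have := extension_additive d
  refine ⟨extension d, extensionIso d, ⟨this, ?_⟩, fun G _ γ => ⟨extensionHom d γ,
    extensionIso_hom_extensionHom d γ, fun β hβ => extension_hom_ext d ?_⟩⟩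
  · rintro S ⟨T, hT, ⟨R⟩⟩
    exact RightExactStructure.conflation_of_retract hW₃
      ((R.map (extension d).mapShortComplex).trans
        (Retract.ofIso (T.mapNatIso (extensionIso d)).symm)) (hF T hT)
  · rw [← cancel_epi (extensionIso d).hom, ← hβ, ← extensionIso_hom_extensionHom]

/-! ### Padding complexes by contractible ones. -/

section Expansions

variable {C : Type u} [Category.{v} C] [Preadditive C]
  {D : Type u₂} [Category.{v₂} D] [Preadditive D] {j : C ⥤ D} [j.Additive]

variable (j) in
/-- A complex `Y` whose image is the direct sum of `X` and a contractible complex. -/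
structure Expansion (X : CochainComplex D ℤ) where
  /-- the complex in the source category -/
  Y : CochainComplex C ℤ
  /-- the objects of the contractible complex -/
  c : ℤ → D
  /-- the inclusion of `X` -/
  ι (n : ℤ) : X.X n ⟶ j.obj (Y.X n)
  /-- the projection to `X` -/
  π (n : ℤ) : j.obj (Y.X n) ⟶ X.X n
  /-- the inclusion of the boundaries -/
  a (n : ℤ) : c n ⟶ j.obj (Y.X n)
  /-- the projection to the boundaries -/
  a' (n : ℤ) : j.obj (Y.X n) ⟶ c n
  /-- the inclusion of the complement of the cycles -/
  b (n : ℤ) : c (n + 1) ⟶ j.obj (Y.X n)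
  /-- the projection to the complement of the cycles -/
  b' (n : ℤ) : j.obj (Y.X n) ⟶ c (n + 1)
  ι_π (n : ℤ) : ι n ≫ π n = 𝟙 _
  ι_b' (n : ℤ) : ι n ≫ b' n = 0
  a_π (n : ℤ) : a n ≫ π n = 0
  a_a' (n : ℤ) : a n ≫ a' n = 𝟙 _
  ι_a' (n : ℤ) : ι n ≫ a' n = 0
  b_b' (n : ℤ) : b n ≫ b' n = 𝟙 _
  b_π (n : ℤ) : b n ≫ π n = 0
  total (n : ℤ) : π n ≫ ι n + a' n ≫ a n + b' n ≫ b n = 𝟙 _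
  map_d (n : ℤ) : j.map (Y.d n (n + 1)) = π n ≫ X.d n (n + 1) ≫ ι (n + 1) + b' n ≫ a (n + 1)

namespace Expansion

variable {X : CochainComplex D ℤ} (E : Expansion j X)

theorem ι_d (i k : ℤ) (h : i + 1 = k) : E.ι i ≫ j.map (E.Y.d i k) = X.d i k ≫ E.ι k := by
  subst h
  simp [E.map_d, reassoc_of% E.ι_π, reassoc_of% E.ι_b']

theorem π_d (i k : ℤ) (h : i + 1 = k) : E.π i ≫ X.d i k = j.map (E.Y.d i k) ≫ E.π k := by
  subst h
  simp [E.map_d, E.ι_π, E.a_π]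

/-- The inclusion of `X`, as a morphism of complexes. -/
def incl : X ⟶ (j.mapHomologicalComplex (ComplexShape.up ℤ)).obj E.Y where
  f := E.ι
  comm' := E.ι_d

/-- The projection to `X`, as a morphism of complexes. -/
def proj : (j.mapHomologicalComplex (ComplexShape.up ℤ)).obj E.Y ⟶ X where
  f := E.π
  comm' := E.π_d

/-- The contracting homotopy. -/
def contraction (i k : ℤ) (h : (ComplexShape.up ℤ).Rel k i) :
    j.obj (E.Y.X i) ⟶ j.obj (E.Y.X k) :=
  E.a' i ≫ eqToHom (congrArg E.c h.symm) ≫ E.b k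

theorem contraction_eq (k : ℤ) : E.contraction (k + 1) k rfl = E.a' (k + 1) ≫ E.b k := by
  simp [contraction]

theorem id_sub (m : ℤ) : 𝟙 _ - E.π (m + 1) ≫ E.ι (m + 1) =
    j.map (E.Y.d (m + 1) (m + 1 + 1)) ≫ E.contraction (m + 1 + 1) (m + 1) rfl +
      E.contraction (m + 1) m rfl ≫ j.map (E.Y.d m (m + 1)) := by
  rw [contraction_eq, contraction_eq, E.map_d, E.map_d, ← E.total]
  simp [reassoc_of% E.ι_a', reassoc_of% E.a_a', reassoc_of% E.b_π, reassoc_of% E.b_b']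
  abel

/-- The complex `X` is homotopy equivalent to the image of `Y`. -/
def homotopyEquiv : HomotopyEquiv X ((j.mapHomologicalComplex (ComplexShape.up ℤ)).obj E.Y) where
  hom := E.incl
  inv := E.proj
  homotopyHomInvId := Homotopy.ofEq (by ext n; exact E.ι_π n)
  homotopyInvHomId := by
    refine (Homotopy.equivSubZero.symm ((Homotopy.ofEq ?_).trans
      (Homotopy.nullHomotopy' (C := (j.mapHomologicalComplex (ComplexShape.up ℤ)).obj E.Y)
        (D := (j.mapHomologicalComplex (ComplexShape.up ℤ)).obj E.Y) E.contraction))).symm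
    ext n
    obtain ⟨m, rfl⟩ : ∃ m, n = m + 1 := ⟨n - 1, by lia⟩
    exact (E.id_sub m).trans (Homotopy.nullHomotopicMap'_f
      (C := (j.mapHomologicalComplex (ComplexShape.up ℤ)).obj E.Y)
      (D := (j.mapHomologicalComplex (ComplexShape.up ℤ)).obj E.Y)
      (k₂ := m) (k₁ := m + 1) (k₀ := m + 1 + 1) rfl rfl E.contraction).symm

variable [j.Full] [j.Faithful]

section

variable [HasBinaryBiproducts D] (X : CochainComplex D ℤ) (c : ℤ → D) (B : ℤ → C)
  (φ : ∀ n, j.obj (B n) ≅ (X.X n ⊞ c n) ⊞ c (n + 1))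

/-- The differential of the direct sum of `X` and a contractible complex. -/
def sumD (n : ℤ) : (X.X n ⊞ c n) ⊞ c (n + 1) ⟶ (X.X (n + 1) ⊞ c (n + 1)) ⊞ c (n + 1 + 1) :=
  biprod.fst ≫ biprod.fst ≫ X.d n (n + 1) ≫ biprod.inl ≫ biprod.inl +
    biprod.snd ≫ biprod.inr ≫ biprod.inl

theorem sumD_sumD (n : ℤ) : sumD X c n ≫ sumD X c (n + 1) = 0 := by
  simp [sumD]

variable {X c B}

/-- The differential of the direct sum of `X` and a contractible complex, in the source
category. -/
def preimageD (n : ℤ) : B n ⟶ B (n + 1) :=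
  j.preimage ((φ n).hom ≫ sumD X c n ≫ (φ (n + 1)).inv)

theorem preimageD_preimageD (n : ℤ) : preimageD φ n ≫ preimageD φ (n + 1) = 0 :=
  j.map_injective (by simp [preimageD, reassoc_of% (sumD_sumD X c n)])

/-- The complex with objects `B n` whose image is the direct sum of `X` and a contractible
complex. -/
def preimageComplex : CochainComplex C ℤ :=
  CochainComplex.of B (preimageD φ) (preimageD_preimageD φ)

/-- The image of the complex `preimageComplex φ` in each degree. -/
def preimageIso (n : ℤ) : j.obj ((preimageComplex φ).X n) ≅ (X.X n ⊞ c n) ⊞ c (n + 1) := φ n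

theorem map_preimageComplex_d (n : ℤ) : j.map ((preimageComplex φ).d n (n + 1)) =
    (preimageIso φ n).hom ≫ sumD X c n ≫ (preimageIso φ (n + 1)).inv :=
  (congrArg j.map (CochainComplex.of_d _ (preimageD φ) n)).trans (j.map_preimage _)

theorem biprod_biprod_total {X Y Z : D} :
    biprod.fst ≫ biprod.fst ≫ biprod.inl ≫ biprod.inl +
      biprod.fst ≫ biprod.snd ≫ biprod.inr ≫ biprod.inl + biprod.snd ≫ biprod.inr =
      𝟙 ((X ⊞ Y) ⊞ Z) := by
  ext <;> simp

/-- Construction of an expansion from the objects of the complex `Y`. -/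
def ofIsos : Expansion j X where
  Y := preimageComplex φ
  c := c
  ι n := biprod.inl ≫ biprod.inl ≫ (preimageIso φ n).inv
  π n := (preimageIso φ n).hom ≫ biprod.fst ≫ biprod.fst
  a n := biprod.inr ≫ biprod.inl ≫ (preimageIso φ n).inv
  a' n := (preimageIso φ n).hom ≫ biprod.fst ≫ biprod.snd
  b n := biprod.inr ≫ (preimageIso φ n).inv
  b' n := (preimageIso φ n).hom ≫ biprod.snd
  ι_π n := by simp
  ι_b' n := by simp
  a_π n := by simp
  a_a' n := by simp
  ι_a' n := by simp
  b_b' n := by simp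
  b_π n := by simp
  total n := by
    have := (preimageIso φ n).hom ≫= biprod_biprod_total =≫ (preimageIso φ n).inv
    simpa using this
  map_d n := by
    rw [map_preimageComplex_d]
    simp [sumD]

end

end Expansion

end Expansions

/-! ### The equivalence of bounded homotopy categories. -/

section KbEquivalence

variable {C : Type u} [Category.{v} C] [Preadditive C] [HasZeroObject C] [HasBinaryBiproducts C]
  {D : Type u₂} [Category.{v₂} D] [Preadditive D] [HasZeroObject D] [HasBinaryBiproducts D]
  (j : C ⥤ D) [j.Additive]

instance [j.Full] [j.Faithful] : (mapKb j).Full where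
  map_surjective f :=
    ⟨ObjectProperty.homMk ((j.mapHomotopyCategory (ComplexShape.up ℤ)).preimage f.hom),
      ObjectProperty.hom_ext _ ((j.mapHomotopyCategory (ComplexShape.up ℤ)).map_preimage f.hom)⟩

instance [j.Full] [j.Faithful] : (mapKb j).Faithful where
  map_injective h := ObjectProperty.hom_ext _ ((j.mapHomotopyCategory (ComplexShape.up ℤ)).map_injective
      ((ObjectProperty.ι _).congr_map h))

instance : (mapKb j).IsTriangulated :=
  ObjectProperty.isTriangulated_lift (bounded D)
    ((bounded C).ι ⋙ j.mapHomotopyCategory (ComplexShape.up ℤ)) _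

variable {j}

/-- A bounded complex, as an object of the bounded homotopy category. -/
def Kb.mk (Y : CochainComplex C ℤ) (a b : ℤ) (ha : Y.IsStrictlyGE a) (hb : Y.IsStrictlyLE b) :
    Kb C :=
  ⟨(HomotopyCategory.quotient _ _).obj Y, a, b, ha, hb⟩

/-- The image of an expansion of a bounded complex in the bounded homotopy category. -/
def Expansion.isoKb {X : Kb D} (E : Expansion j X.obj.as) (a b : ℤ) (ha : E.Y.IsStrictlyGE a)
    (hb : E.Y.IsStrictlyLE b) : (mapKb j).obj (Kb.mk E.Y a b ha hb) ≅ X :=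
  (bounded D).isoMk (HomotopyCategory.isoOfHomotopyEquiv E.homotopyEquiv.symm)

/-- Choosing a zero complement for a zero object keeps the padded complexes bounded. -/
theorem exists_iso_complement [j.Full] [j.Faithful]
    (hj : ∀ X : D, ∃ A B : C, Nonempty (X ⊞ j.obj A ≅ j.obj B)) (X : D) :
    ∃ A B : C, Nonempty (X ⊞ j.obj A ≅ j.obj B) ∧ (IsZero X → IsZero A) := by
  by_cases hX : IsZero X
  · have h₀ : IsZero (j.obj 0) := j.map_isZero (isZero_zero C)
    refine ⟨0, 0, ⟨?_⟩, fun _ => isZero_zero C⟩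
    exact IsZero.iso (by rw [biprod_isZero_iff]; exact ⟨hX, h₀⟩) h₀
  · obtain ⟨A, B, h⟩ := hj X
    exact ⟨A, B, h, fun h => (hX h).elim⟩

theorem isZero_of_map [j.Faithful] {B : C} (h : IsZero (j.obj B)) : IsZero B := by
  rw [IsZero.iff_id_eq_zero]
  exact j.map_injective (h.eq_of_src _ _)

/-- Degree n contains `c n` and `c (n + 1)`, and their vanishing is controlled by X in degrees n -
1, n and n + 1; hence the bounds widen by one on each side. -/
theorem Expansion.bounds_ofIsos [j.Full] [j.Faithful] {X : CochainComplex D ℤ} {c : ℤ → D}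
    {B : ℤ → C} (φ : ∀ n, j.obj (B n) ≅ (X.X n ⊞ c n) ⊞ c (n + 1)) {a b : ℤ}
    (ha : X.IsStrictlyGE a) (hb : X.IsStrictlyLE b)
    (hc : ∀ n, IsZero (X.X (n - 1)) → IsZero (X.X n) → IsZero (c n)) :
    (Expansion.ofIsos φ).Y.IsStrictlyGE (a - 1) ∧
      (Expansion.ofIsos φ).Y.IsStrictlyLE (b + 1) := by
  have key (n : ℤ) (h₁ : IsZero (X.X (n - 1))) (h₂ : IsZero (X.X n)) (h₃ : IsZero (X.X (n + 1))) :
      IsZero ((Expansion.ofIsos φ).Y.X n) := by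
    apply isZero_of_map (j := j)
    refine IsZero.of_iso ?_ (φ n)
    simp only [biprod_isZero_iff]
    exact ⟨⟨h₂, hc n h₁ h₂⟩, hc (n + 1) (by rwa [add_sub_cancel_right]) h₃⟩
  rw [CochainComplex.isStrictlyGE_iff, CochainComplex.isStrictlyLE_iff]
  exact ⟨fun n hn => key n (X.isZero_of_isStrictlyGE a _ (by lia))
      (X.isZero_of_isStrictlyGE a _ (by lia)) (X.isZero_of_isStrictlyGE a _ (by lia)),
    fun n hn => key n (X.isZero_of_isStrictlyLE b _ (by lia))
      (X.isZero_of_isStrictlyLE b _ (by lia)) (X.isZero_of_isStrictlyLE b _ (by lia))⟩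

theorem essSurj_mapKb [j.Full] [j.Faithful]
    (hj : ∀ X : D, ∃ A B : C, Nonempty (X ⊞ j.obj A ≅ j.obj B)) : (mapKb j).EssSurj where
  mem_essImage X := by
    obtain ⟨a, b, ha, hb⟩ := X.property
    choose A B φ hA using fun n => exists_iso_complement hj (X.obj.as.X n)
    have ψ (n : ℤ) : j.obj (B n ⊞ A (n + 1)) ≅ (X.obj.as.X n ⊞ j.obj (A n)) ⊞ j.obj (A (n + 1)) :=
      haveI := preservesBinaryBiproducts_of_preservesBiproducts j
      j.mapBiprod _ _ ≪≫ biprod.mapIso (φ n).some.symm (Iso.refl _)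
    obtain ⟨ha', hb'⟩ := Expansion.bounds_ofIsos ψ ha hb
      (fun n _ h => j.map_isZero (hA n h))
    exact ⟨_, ⟨(Expansion.ofIsos ψ).isoKb _ _ ha' hb'⟩⟩

end KbEquivalence

/-! ### Acyclic complexes as splicings of conflations. -/

section Acyclic

variable {C : Type u} [Category.{v} C] [Preadditive C] {e : RightExactStructure C}

namespace RightExactStructure

theorem acyclicAt_of_isKer {X : CochainComplex C ℤ} {k l m n : ℤ} (hk : k + 1 = l)
    (hl : l + 1 = m) (hn : m + 1 = n) {Z : C} (p : X.X l ⟶ Z) (i : Z ⟶ X.X m)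
    (hpi : p ≫ i = X.d l m) (hp : e.IsDeflation p) (hi : e.IsInflation i)
    (h₁ : IsCoker (X.d k l) p) (h₂ : IsKer i (X.d m n)) : e.AcyclicAt X m := by
  obtain rfl : l = m - 1 := by lia
  obtain rfl : k = m - 2 := by lia
  subst hn
  exact ⟨Z, p, i, hpi, hp, hi, ⟨h₁.zero, (isCoker_iff h₁.zero).1 h₁⟩,
    ⟨h₂.zero, (isKer_iff h₂.zero).1 h₂⟩⟩

/-- Indexing the deflation by l with l + 1 = m allows m = n + 1 without transport along n + 1 - 1 =
n. -/
theorem AcyclicAt.exists_isKer {X : CochainComplex C ℤ} {m : ℤ} (h : e.AcyclicAt X m) :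
    ∃ (Z : C) (i : Z ⟶ X.X m) (p : ∀ l, l + 1 = m → (X.X l ⟶ Z)), e.IsInflation i ∧
      IsKer i (X.d m (m + 1)) ∧ ∀ l hl, p l hl ≫ i = X.d l m ∧ e.IsDeflation (p l hl) := by
  obtain ⟨Z, p, i, hpi, hp, hi, -, ⟨w, h⟩⟩ := h
  refine ⟨Z, i, fun l hl => (X.XIsoOfEq (by lia : l = m - 1)).hom ≫ p, hi, (isKer_iff w).2 h,
    fun l hl => ?_⟩
  obtain rfl : l = m - 1 := by lia
  simpa using ⟨hpi, hp⟩

theorem acyclic_of_conflations {X : CochainComplex C ℤ} (Z : ℤ → C) (p : ∀ n, X.X n ⟶ Z n)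
    (i : ∀ n, Z n ⟶ X.X (n + 1)) (w : ∀ n, i n ≫ p (n + 1) = 0)
    (h : ∀ n, e.conflation (ShortComplex.mk (i n) (p (n + 1)) (w n)))
    (hd : ∀ n, p n ≫ i n = X.d n (n + 1)) : e.Acyclic X := by
  intro m
  -- Three degrees back, so that `h k` shows that `p (k + 1)` is epi.
  obtain ⟨k, rfl⟩ : ∃ k, m = k + 1 + 1 + 1 := ⟨m - 3, by lia⟩
  refine acyclicAt_of_isKer rfl rfl rfl (p (k + 1 + 1)) (i (k + 1 + 1)) (hd _) ⟨_, _, _, h _⟩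
    ⟨_, _, _, h _⟩ ?_ ?_
  · rw [← hd]
    have := (e.isCoker (h k)).epi
    exact (e.isCoker (h (k + 1))).epi_comp _
  · rw [← hd]
    have := (e.isKer (h (k + 1 + 1 + 1))).mono
    exact (e.isKer (h (k + 1 + 1))).comp_mono _

/-- The differential is the next deflation followed by a mono, so the kernel of the differential is
the kernel of that deflation. -/
theorem Acyclic.exists_conflations {X : CochainComplex C ℤ} (h : e.Acyclic X) :
    ∃ (Z : ℤ → C) (p : ∀ n, X.X n ⟶ Z n) (i : ∀ n, Z n ⟶ X.X (n + 1))
      (w : ∀ n, i n ≫ p (n + 1) = 0),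
      (∀ n, e.conflation (ShortComplex.mk (i n) (p (n + 1)) (w n))) ∧
      (∀ n, e.IsDeflation (p n)) ∧ ∀ n, p n ≫ i n = X.d n (n + 1) := by
  choose Z i p hi hk hp using fun n => (h (n + 1)).exists_isKer
  have key (n : ℤ) : IsKer (i n) (p (n + 1) (n + 1) rfl) := by
    have := (hi (n + 1)).mono
    refine IsKer.of_comp_mono (i (n + 1)) ?_
    rw [(hp (n + 1) (n + 1) rfl).1]
    exact hk n
  exact ⟨Z, fun n => p n n rfl, i, fun n => (key n).zero,
    fun n => (hp (n + 1) (n + 1) rfl).2.conflation (key n), fun n => (hp n n rfl).2,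
    fun n => (hp n n rfl).1⟩

theorem Acyclic.map {D : Type u₂} [Category.{v₂} D] [Preadditive D] {e' : RightExactStructure D}
    {F : C ⥤ D} [F.Additive] (hF : ∀ S : ShortComplex C, e.conflation S → e'.conflation (S.map F))
    {X : CochainComplex C ℤ} (h : e.Acyclic X) :
    e'.Acyclic ((F.mapHomologicalComplex (ComplexShape.up ℤ)).obj X) := by
  obtain ⟨Z, p, i, w, h, -, hd⟩ := h.exists_conflations
  exact acyclic_of_conflations (X := (F.mapHomologicalComplex (ComplexShape.up ℤ)).obj X)
    (fun n => F.obj (Z n)) (fun n => F.map (p n)) (fun n => F.map (i n))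
    (fun n => (F.map_comp _ _).symm.trans ((congrArg F.map (w n)).trans (F.map_zero _ _)))
    (fun n => hF _ (h n)) (fun n => (F.map_comp _ _).symm.trans (congrArg F.map (hd n)))

end RightExactStructure

end Acyclic

/-! ### Padding deflations of the completion into images of deflations. -/

section DeflationImages

variable {C : Type u} [Category.{v} C] [Preadditive C] [HasZeroObject C] [HasBinaryBiproducts C]
  {D : Type u₂} [Category.{v₂} D] [Preadditive D] [HasBinaryBiproducts D]
  {e : RightExactStructure C} {j : C ⥤ D}

variable (e j) in
/-- The morphism `h` is isomorphic to the image of a deflation. -/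
def IsDeflationImage {Y Z : D} (h : Y ⟶ Z) : Prop :=
  ∃ (U V : C) (t : U ⟶ V) (φ : j.obj U ≅ Y) (ψ : j.obj V ≅ Z),
    e.IsDeflation t ∧ φ.hom ≫ h = j.map t ≫ ψ.hom

/-- The direct sum of the morphisms `g`, `c ⟶ 0` and the identity of `b`. -/
abbrev sumHom {Y Z : D} (g : Y ⟶ Z) (c b : D) : (Y ⊞ c) ⊞ b ⟶ Z ⊞ b :=
  biprod.map (biprod.fst ≫ g) (𝟙 b)

theorem IsDeflationImage.of_iso {Y Z Y' Z' : D} {h : Y ⟶ Z} (H : IsDeflationImage e j h)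
    {h' : Y' ⟶ Z'} (a : Y ≅ Y') (b : Z ≅ Z') (w : a.hom ≫ h' = h ≫ b.hom) :
    IsDeflationImage e j h' := by
  obtain ⟨U, V, t, φ, ψ, ht, hw⟩ := H
  exact ⟨U, V, t, φ ≪≫ a, ψ ≪≫ b, ht, by simp [w, reassoc_of% hw]⟩

section

variable [j.Additive]

/-- An additive functor preserves direct sums of two objects. -/
def mapSumIso (j : C ⥤ D) [j.Additive] (X Y : C) : j.obj (X ⊞ Y) ≅ j.obj X ⊞ j.obj Y where
  hom := biprod.lift (j.map biprod.fst) (j.map biprod.snd)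
  inv := biprod.desc (j.map biprod.inl) (j.map biprod.inr)
  hom_inv_id := by
    rw [biprod.lift_desc, ← j.map_comp, ← j.map_comp, ← j.map_add, biprod.total, j.map_id]
  inv_hom_id := by
    ext <;> simp [← j.map_comp]

theorem mapSumIso_hom_fst (X Y : C) : (mapSumIso j X Y).hom ≫ biprod.fst = j.map biprod.fst := by
  simp [mapSumIso]

theorem mapSumIso_hom_snd (X Y : C) : (mapSumIso j X Y).hom ≫ biprod.snd = j.map biprod.snd := by
  simp [mapSumIso]

theorem map_map_mapSumIso_hom {X Y X' Y' : C} (f : X ⟶ X') (g : Y ⟶ Y') :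
    j.map (biprod.map f g) ≫ (mapSumIso j X' Y').hom =
      (mapSumIso j X Y).hom ≫ biprod.map (j.map f) (j.map g) := by
  ext
  · simp only [Category.assoc, mapSumIso_hom_fst, biprod.map_fst, ← j.map_comp]
    rw [← Category.assoc, mapSumIso_hom_fst, j.map_comp]
  · simp only [Category.assoc, mapSumIso_hom_snd, biprod.map_snd, ← j.map_comp]
    rw [← Category.assoc, mapSumIso_hom_snd, j.map_comp]

theorem isDeflation_biprod_fst (h₀ : e.R0Star) (X Y : C) :
    e.IsDeflation (biprod.fst : X ⊞ Y ⟶ X) :=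
  (RightExactStructure.isDeflation_biprod_snd h₀ Y X).of_iso (biprod.braiding Y X) (Iso.refl _)
    (by simp)

theorem isDeflation_biprod_map_id {V W : C} {q : V ⟶ W} (hq : e.IsDeflation q) (X : C) :
    e.IsDeflation (biprod.map q (𝟙 X)) :=
  (RightExactStructure.isDeflation_of_isPullback
    (RightExactStructure.isPullback_biprod_map X q) hq).of_iso (biprod.braiding X V)
      (biprod.braiding X W) (by ext <;> simp)

theorem IsDeflationImage.sumHom_map (h₀ : e.R0Star) {Y Z : D} {g : Y ⟶ Z}
    (h : IsDeflationImage e j g) (A B : C) :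
    IsDeflationImage e j (sumHom g (j.obj A) (j.obj B)) := by
  obtain ⟨U, V, t, φ, ψ, ht, hw⟩ := h
  refine ⟨(U ⊞ A) ⊞ B, V ⊞ B, biprod.map (biprod.fst ≫ t) (𝟙 B),
    mapSumIso j _ _ ≪≫ biprod.mapIso (mapSumIso j _ _ ≪≫ biprod.mapIso φ (Iso.refl _)) (Iso.refl _),
    mapSumIso j _ _ ≪≫ biprod.mapIso ψ (Iso.refl _),
    isDeflation_biprod_map_id (e.r1 _ _ (isDeflation_biprod_fst h₀ _ _) ht) B, ?_⟩
  have h₁ := fun X Y => reassoc_of% (mapSumIso_hom_fst (j := j) X Y)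
  simp only [Iso.trans_hom, reassoc_of% (map_map_mapSumIso_hom (j := j)), Category.assoc]
  congr 1
  ext <;> simp [h₁, hw]

theorem IsDeflationImage.of_sumHom_sumHom {Y Z : D} {g : Y ⟶ Z} {c b c' b' : D}
    (h : IsDeflationImage e j (sumHom (sumHom g c b) c' b')) :
    IsDeflationImage e j (sumHom g (c ⊞ c') (b ⊞ b')) :=
  h.of_iso
    { hom := biprod.lift (biprod.lift (biprod.fst ≫ biprod.fst ≫ biprod.fst ≫ biprod.fst)
        (biprod.lift (biprod.fst ≫ biprod.fst ≫ biprod.fst ≫ biprod.snd)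
          (biprod.fst ≫ biprod.snd)))
        (biprod.lift (biprod.fst ≫ biprod.fst ≫ biprod.snd) biprod.snd)
      inv := biprod.lift (biprod.lift (biprod.lift (biprod.lift (biprod.fst ≫ biprod.fst)
        (biprod.fst ≫ biprod.snd ≫ biprod.fst)) (biprod.snd ≫ biprod.fst))
          (biprod.fst ≫ biprod.snd ≫ biprod.snd)) (biprod.snd ≫ biprod.snd) }
    (biprod.associator _ _ _) (by ext <;> simp)

end

section

variable [j.Full] [j.Faithful] [j.Additive]

/-- Complement Y to jU and Z to jW, and add a deflation q : V ⟶ W over which the projection jW ⟶ Z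
lifts. The resulting row is a deflation. The components of q factor through g, by v, and through the
identity of jB, so a shear turns it into the direct sum of g, zero on jA ⊞ jV, and the identity of
jB. -/
theorem LiftsDeflations.exists_isDeflationImage (h₀ : e.R0Star)
    (hj : ∀ X : D, ∃ A B : C, Nonempty (X ⊞ j.obj A ≅ j.obj B)) {Y Z : D} {g : Y ⟶ Z}
    (hg : LiftsDeflations e j g) :
    ∃ A B : C, IsDeflationImage e j (sumHom g (j.obj A) (j.obj B)) := by
  obtain ⟨A, U, ⟨φ⟩⟩ := hj Y
  obtain ⟨B, W, ⟨ψ⟩⟩ := hj Z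
  obtain ⟨V, q, v, hq, w⟩ := hg (ψ.inv ≫ biprod.fst)
  obtain ⟨f₁, hf₁⟩ := j.map_surjective (φ.inv ≫ biprod.fst ≫ g ≫ biprod.inl ≫ ψ.hom)
  obtain ⟨f₂, hf₂⟩ := j.map_surjective (biprod.inr ≫ ψ.hom)
  refine ⟨A ⊞ V, B, IsDeflationImage.of_iso (h := biprod.desc (biprod.desc (φ.inv ≫ biprod.fst ≫ g ≫
    biprod.inl ≫ ψ.hom) (biprod.inr ≫ ψ.hom)) (j.map q)) ?_
    (((?_ : _ ≅ ((Y ⊞ (j.obj A ⊞ j.obj V)) ⊞ j.obj B))) ≪≫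
      biprod.mapIso (biprod.mapIso (Iso.refl _) (mapSumIso j _ _).symm) (Iso.refl _)) ψ.symm ?_⟩
  · refine ⟨(U ⊞ B) ⊞ V, W, biprod.desc (biprod.desc f₁ f₂) q,
      mapSumIso j _ _ ≪≫ biprod.mapIso (mapSumIso j _ _) (Iso.refl _), Iso.refl _,
      RightExactStructure.isDeflation_biprod_desc h₀ _ hq, ?_⟩
    rw [← hf₁, ← hf₂]
    have : biprod.desc (biprod.desc f₁ f₂) q =
      biprod.fst ≫ biprod.fst ≫ f₁ + biprod.fst ≫ biprod.snd ≫ f₂ + biprod.snd ≫ q := by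
      ext <;> simp
    rw [this]
    simp [mapSumIso, biprod.desc_eq]
  · exact
    { hom := biprod.lift (biprod.lift (biprod.fst ≫ biprod.fst ≫ φ.inv ≫ biprod.fst +
          biprod.snd ≫ v) (biprod.lift (biprod.fst ≫ biprod.fst ≫ φ.inv ≫ biprod.snd) biprod.snd))
        (biprod.fst ≫ biprod.snd + biprod.snd ≫ j.map q ≫ ψ.inv ≫ biprod.snd)
      inv := biprod.lift (biprod.lift
        ((biprod.fst ≫ biprod.fst - biprod.fst ≫ biprod.snd ≫ biprod.snd ≫ v) ≫
          biprod.inl ≫ φ.hom + biprod.fst ≫ biprod.snd ≫ biprod.fst ≫ biprod.inr ≫ φ.hom)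
          (biprod.snd - biprod.fst ≫ biprod.snd ≫ biprod.snd ≫ j.map q ≫ ψ.inv ≫ biprod.snd))
          (biprod.fst ≫ biprod.snd ≫ biprod.snd)
      hom_inv_id := by
        have h₁ : φ.inv ≫ (biprod.fst ≫ biprod.inl ≫ φ.hom + biprod.snd ≫ biprod.inr ≫ φ.hom) =
            𝟙 _ := by
          simp only [← Category.assoc, ← Preadditive.add_comp, biprod.total, Category.id_comp,
            Iso.inv_hom_id]
        ext <;> simp
        simpa using h₁
      inv_hom_id := by
        ext <;> simp }
  · ext <;> simp [w]

/-- Zero padding over a zero source, whose target is zero because g is epi, preserves boundedness.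
-/
theorem LiftsDeflations.exists_isDeflationImage_of_epi (h₀ : e.R0Star)
    (hj : ∀ X : D, ∃ A B : C, Nonempty (X ⊞ j.obj A ≅ j.obj B)) {Y Z : D} {g : Y ⟶ Z} [Epi g]
    (hg : LiftsDeflations e j g) :
    ∃ A B : C, IsDeflationImage e j (sumHom g (j.obj A) (j.obj B)) ∧
      (IsZero Y → IsZero A ∧ IsZero B) := by
  by_cases hY : IsZero Y
  · have hZ : IsZero Z := by
      rw [IsZero.iff_id_eq_zero, ← cancel_epi g]
      exact hY.eq_of_src _ _
    have h0 : IsZero (0 : C) := isZero_zero C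
    have hj0 : IsZero (j.obj 0) := j.map_isZero h0
    have h₁ : IsZero (Z ⊞ j.obj 0) := by simp [biprod_isZero_iff, hZ, hj0]
    have h₂ : IsZero ((Y ⊞ j.obj 0) ⊞ j.obj 0) := by simp [biprod_isZero_iff, hY, hj0]
    exact ⟨0, 0, ⟨0, 0, 0, hj0.iso h₂, hj0.iso h₁, e.isDeflation_of_isZero _ h0 h0,
      hj0.eq_of_src _ _⟩, fun _ => ⟨h0, h0⟩⟩
  · obtain ⟨A, B, h⟩ := hg.exists_isDeflationImage h₀ hj
    exact ⟨A, B, h, fun h => (hY h).elim⟩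

/-- Padding may be enlarged freely. This lets neighbouring degrees share a summand; the order of the
summands is the one that sharing requires. -/
theorem IsDeflationImage.sumHom_biprod (h₀ : e.R0Star) {Y Z : D} {g : Y ⟶ Z} {A B : C}
    (h : IsDeflationImage e j (sumHom g (j.obj A) (j.obj B))) (A' B' : C) :
    IsDeflationImage e j (sumHom g (j.obj (A ⊞ A')) (j.obj (B' ⊞ B))) :=
  (h.sumHom_map h₀ A' B').of_sumHom_sumHom.of_iso
    (biprod.mapIso (biprod.mapIso (Iso.refl _) (mapSumIso j A A').symm)
      ((mapSumIso j B B').symm ≪≫ j.mapIso (biprod.braiding B B')))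
    (biprod.mapIso (Iso.refl _) ((mapSumIso j B B').symm ≪≫ j.mapIso (biprod.braiding B B')))
    (by ext <;> simp)

end

theorem isKer_sumHom {X Y Z : D} {f : X ⟶ Y} {g : Y ⟶ Z} (h : IsKer f g) (c b : D) :
    IsKer (biprod.map f (𝟙 c) ≫ biprod.inl) (sumHom g c b) where
  zero := by ext <;> simp [h.zero]
  mono := by
    have := h.mono
    infer_instance
  lift T t ht := by
    have h₁ := ht =≫ biprod.fst
    have h₂ := ht =≫ biprod.snd
    simp only [Category.assoc, biprod.map_fst, biprod.map_snd, zero_comp, Category.comp_id]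
      at h₁ h₂
    obtain ⟨l, hl⟩ := h.lift (t ≫ biprod.fst ≫ biprod.fst) (by simpa using h₁)
    exact ⟨biprod.lift l (t ≫ biprod.fst ≫ biprod.snd), by ext <;> simp [hl, h₂]⟩

end DeflationImages

/-! ### Acyclic complexes over the completion come from the original category. -/

section AcyclicPreimages

variable {C : Type u} [Category.{v} C] [Preadditive C] [HasZeroObject C] [HasBinaryBiproducts C]
  {D : Type u₂} [Category.{v₂} D] [Preadditive D] [HasZeroObject D] [HasBinaryBiproducts D]
  {e : RightExactStructure C} {j : C ⥤ D} [j.Full] [j.Faithful] [j.Additive]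

theorem IsKer.of_map {X Y Z : C} {f : X ⟶ Y} {g : Y ⟶ Z} (h : IsKer (j.map f) (j.map g)) :
    IsKer f g where
  zero := j.map_injective (by simpa using h.zero)
  mono := by
    have := h.mono
    exact j.mono_of_mono_map this
  lift T t ht := by
    obtain ⟨l, hl⟩ := h.lift (j.map t) (by rw [← j.map_comp, ht, j.map_zero])
    obtain ⟨l, rfl⟩ := j.map_surjective l
    exact ⟨l, j.map_injective (by rw [j.map_comp, hl])⟩

theorem IsKer.of_iso {X Y Z X' Y' Z' : D} {f : X ⟶ Y} {g : Y ⟶ Z} (h : IsKer f g)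
    {f' : X' ⟶ Y'} {g' : Y' ⟶ Z'} (a : X' ≅ X) (b : Y' ≅ Y) (c : Z' ≅ Z)
    (hf : a.hom ≫ f = f' ≫ b.hom) (hg : b.hom ≫ g = g' ≫ c.hom) : IsKer f' g' where
  zero := by
    rw [← cancel_mono c.hom, Category.assoc, ← hg, ← reassoc_of% hf, h.zero, comp_zero, zero_comp]
  mono := by
    have := h.mono
    have : Mono (f' ≫ b.hom) := by rw [← hf]; infer_instance
    exact mono_of_mono f' b.hom
  lift T t ht := by
    obtain ⟨l, hl⟩ := h.lift (t ≫ b.hom) (by rw [Category.assoc, hg, reassoc_of% ht, zero_comp])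
    exact ⟨l ≫ a.inv, by rw [← cancel_mono b.hom, Category.assoc, Category.assoc, ← hf,
      Iso.inv_hom_id_assoc, hl]⟩

/-- The padded complex splices the sums of the conflations of X with the trivial sequences on `c n`.
Their deflations are images of the `t n`, and `j` reflects kernels, so the conflations lie in the
source category. -/
theorem acyclic_preimageComplex {X : CochainComplex D ℤ} {Z c : ℤ → D} {p : ∀ n, X.X n ⟶ Z n}
    {i : ∀ n, Z n ⟶ X.X (n + 1)} (hp : ∀ n, IsKer (i n) (p (n + 1)))
    (hd : ∀ n, p n ≫ i n = X.d n (n + 1)) {U V : ℤ → C} {t : ∀ n, U n ⟶ V n}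
    (φ : ∀ n, j.obj (U n) ≅ (X.X n ⊞ c n) ⊞ c (n + 1)) (ψ : ∀ n, j.obj (V n) ≅ Z n ⊞ c (n + 1))
    (ht : ∀ n, e.IsDeflation (t n))
    (hw : ∀ n, (φ n).hom ≫ sumHom (p n) (c n) (c (n + 1)) = j.map (t n) ≫ (ψ n).hom) :
    e.Acyclic (Expansion.preimageComplex φ) := by
  let i' (n : ℤ) : V n ⟶ U (n + 1) := j.preimage ((ψ n).hom ≫
    (biprod.map (i n) (𝟙 _) ≫ biprod.inl) ≫ (φ (n + 1)).inv)
  have hi' (n : ℤ) : IsKer (i' n) (t (n + 1)) := by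
    refine IsKer.of_map (j := j) ((isKer_sumHom (hp n) (c (n + 1)) (c (n + 1 + 1))).of_iso (ψ n)
      (φ (n + 1)) (ψ (n + 1)) ?_ (hw (n + 1)))
    simp [i']
  have hcomp (n : ℤ) : j.map (t n) ≫ (ψ n).hom ≫
      (biprod.map (i n) (𝟙 (c (n + 1))) ≫ biprod.inl) ≫ (φ (n + 1)).inv =
        (φ n).hom ≫ Expansion.sumD X c n ≫ (φ (n + 1)).inv := by
    rw [← reassoc_of% (hw n), ← Category.assoc (sumHom _ _ _)]
    congr 2
    rw [Expansion.sumD, ← hd]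
    ext <;> simp
  refine RightExactStructure.acyclic_of_conflations (X := Expansion.preimageComplex φ) V t i'
    (fun n => (hi' n).zero) (fun n => (ht (n + 1)).conflation (hi' n)) (fun n => ?_)
  apply j.map_injective
  refine (j.map_comp _ _).trans (Eq.trans ?_ (Expansion.map_preimageComplex_d φ n).symm)
  exact (congrArg (j.map (t n) ≫ ·) (j.map_preimage _)).trans (hcomp n)

theorem exists_acyclic_preimage (h₀ : e.R0Star) (hD : WeaklyIdempotentComplete D)
    (hj : ∀ X : D, ∃ A B : C, Nonempty (X ⊞ j.obj A ≅ j.obj B)) {X : Kb D}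
    (hX : (completedStructure e j h₀ hD hj).acyclicKb X) :
    ∃ Y : Kb C, e.acyclicKb Y ∧ Nonempty ((mapKb j).obj Y ≅ X) := by
  obtain ⟨a, b, ha, hb⟩ := X.property
  obtain ⟨Z, p, i, w, h, h', hd⟩ := RightExactStructure.Acyclic.exists_conflations hX
  have hp (n : ℤ) : LiftsDeflations e j (p n) := by
    obtain ⟨K, k, w, H⟩ := h' n
    exact liftsDeflations_of_retractConflation H
  choose A B hAB hz using fun n =>
    have := (h' n).epi
    (hp n).exists_isDeflationImage_of_epi h₀ hj
  -- The same c n is killed in degree n, which requires the summand A n, and is kept identically in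
  -- degree n - 1, which requires B (n - 1).
  let c (n : ℤ) : D := j.obj (A n ⊞ B (n - 1))
  have hc (n : ℤ) : IsDeflationImage e j (sumHom (p n) (c n) (c (n + 1))) := by
    have h₁ : c (n + 1) = j.obj (A (n + 1) ⊞ B n) := by simp only [c, add_sub_cancel_right]
    rw [h₁]
    exact (hAB n).sumHom_biprod h₀ _ _
  choose U V t φ ψ ht hw using hc
  obtain ⟨ha', hb'⟩ := Expansion.bounds_ofIsos φ ha hb (fun n h₁ h₂ => j.map_isZero (by
    rw [biprod_isZero_iff]
    exact ⟨(hz n h₂).1, (hz _ h₁).2⟩))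
  exact ⟨Kb.mk (Expansion.ofIsos φ).Y _ _ ha' hb', acyclic_preimageComplex (fun n => ConflationStructure.isKer _ (h n)) hd φ ψ ht hw,
    ⟨(Expansion.ofIsos φ).isoKb _ _ ha' hb'⟩⟩

theorem acyclicKb_mapKb (h₀ : e.R0Star) (hD : WeaklyIdempotentComplete D)
    (hj : ∀ X : D, ∃ A B : C, Nonempty (X ⊞ j.obj A ≅ j.obj B)) {Y : Kb C}
    (hY : e.acyclicKb Y) : (completedStructure e j h₀ hD hj).acyclicKb ((mapKb j).obj Y) := by
  obtain ⟨_, hF⟩ := isExact_completedStructure (e := e) (j := j) h₀ hD hj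
  exact RightExactStructure.Acyclic.map hF hY

end AcyclicPreimages

/-! ### Thick closures and Verdier quotients under an equivalence. -/

section ThickClosures

open Pretriangulated

variable {K : Type u} [Category.{v} K] [Preadditive K] [HasZeroObject K] [HasShift K ℤ]
  [∀ n : ℤ, (shiftFunctor K n).Additive] [Pretriangulated K] [IsTriangulated K]
  {L : Type u₂} [Category.{v₂} L] [Preadditive L] [HasZeroObject L] [HasShift L ℤ]
  [∀ n : ℤ, (shiftFunctor L n).Additive] [Pretriangulated L] [IsTriangulated L]
  {F : K ⥤ L} [F.CommShift ℤ] [F.IsTriangulated]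
  {P : ObjectProperty K} {Q : ObjectProperty L} [P.Nonempty] [Q.Nonempty]

theorem isStableUnderRetracts_inverseImage (R : ObjectProperty L) [R.IsStableUnderRetracts] :
    (R.inverseImage F).IsStableUnderRetracts where
  of_retract h hY := R.prop_of_retract (h.map F) hY

theorem triangEnvelope_le_inverseImage (h : ∀ X, P X → Q (F.obj X)) :
    P.triangEnvelope ≤ Q.triangEnvelope.inverseImage F := by
  have := isStableUnderRetracts_inverseImage (F := F) Q.triangEnvelope
  rw [ObjectProperty.triangEnvelope_le_iff]
  exact fun X hX => Q.le_triangEnvelope _ (h X hX)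

theorem isStableUnderRetracts_map [F.IsEquivalence] (R : ObjectProperty K)
    [R.IsStableUnderRetracts] : (R.map F).IsStableUnderRetracts where
  of_retract {X Y} h := by
    rintro ⟨Y', hY', ⟨φ⟩⟩
    let r : Retract (F.obj (F.objPreimage X)) (F.obj Y') :=
      { i := (F.objObjPreimageIso X).hom ≫ h.i ≫ φ.inv
        r := φ.hom ≫ h.r ≫ (F.objObjPreimageIso X).inv
        retract := by simp }
    refine ⟨F.objPreimage X, R.prop_of_retract ⟨F.preimage r.i, F.preimage r.r, ?_⟩ hY',
      ⟨F.objObjPreimageIso X⟩⟩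
    exact F.map_injective (by simpa only [F.map_comp, F.map_preimage, F.map_id] using r.retract)

/-- The essential image of a thick subcategory under an equivalence is thick, so it contains the
thick closure of Q once it contains Q. -/
theorem inverseImage_triangEnvelope_le [F.IsEquivalence]
    (h : ∀ X, Q X → ∃ Y, P Y ∧ Nonempty (F.obj Y ≅ X)) :
    Q.triangEnvelope.inverseImage F ≤ P.triangEnvelope := by
  have := isStableUnderRetracts_map (F := F) P.triangEnvelope
  have key : Q.triangEnvelope ≤ P.triangEnvelope.map F := by
    rw [ObjectProperty.triangEnvelope_le_iff]
    intro X hX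
    obtain ⟨Y, hY, hφ⟩ := h X hX
    exact ⟨Y, P.le_triangEnvelope _ hY, hφ⟩
  intro X hX
  obtain ⟨Y, hY, ⟨φ⟩⟩ := key _ hX
  exact P.triangEnvelope.prop_of_iso (F.preimageIso φ) hY

/-- An equivalence under which two properties of objects correspond to each other, as a morphism
of localizers. -/
abbrev verdierMorphism (h : ∀ X, P X → Q (F.obj X)) :
    LocalizerMorphism P.triangEnvelope.trW Q.triangEnvelope.trW where
  functor := F
  map _ _ _ hf := (Q.triangEnvelope.inverseImage_trW_iff F _).1
    (ObjectProperty.trW_monotone (triangEnvelope_le_inverseImage h) _ hf)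

theorem isLocalizedEquivalence_verdierMorphism [F.IsEquivalence] (h : ∀ X, P X → Q (F.obj X))
    (h' : ∀ X, Q X → ∃ Y, P Y ∧ Nonempty (F.obj Y ≅ X)) :
    (verdierMorphism h).IsLocalizedEquivalence := by
  have : (verdierMorphism h).functor.IsEquivalence := inferInstanceAs F.IsEquivalence
  refine LocalizerMorphism.IsLocalizedEquivalence.of_equivalence _ ?_
  intro X Y f hf
  let f' := F.preimage ((F.objObjPreimageIso X).hom ≫ f ≫ (F.objObjPreimageIso Y).inv)
  have hf' : F.map f' = (F.objObjPreimageIso X).hom ≫ f ≫ (F.objObjPreimageIso Y).inv :=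
    F.map_preimage _
  have φ : Arrow.mk (F.map f') ≅ Arrow.mk f :=
    Arrow.isoMk (F.objObjPreimageIso X) (F.objObjPreimageIso Y) (by simp [hf'])
  refine ⟨_, _, f', ObjectProperty.trW_monotone (inverseImage_triangEnvelope_le (F := F) h') _
    ((Q.triangEnvelope.inverseImage_trW_iff F f').2 ?_), ⟨φ⟩⟩
  exact (MorphismProperty.arrow_mk_iso_iff _ φ).2 hf

theorem exists_triangulated_localizedFunctor
    (M : LocalizerMorphism P.triangEnvelope.trW Q.triangEnvelope.trW) [M.functor.CommShift ℤ]
    [M.functor.IsTriangulated] [M.IsLocalizedEquivalence] :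
    ∃ (Φ : P.triangEnvelope.trW.Localization ⥤ Q.triangEnvelope.trW.Localization)
      (_ : Φ.CommShift ℤ), Φ.IsTriangulated ∧ Φ.IsEquivalence ∧
      ∃ α : P.triangEnvelope.trW.Q ⋙ Φ ≅ M.functor ⋙ Q.triangEnvelope.trW.Q,
        NatTrans.CommShift α.hom ℤ := by
  let W₁ := P.triangEnvelope.trW
  let W₂ := Q.triangEnvelope.trW
  let β := CatCommSq.iso M.functor W₁.Q W₂.Q (M.localizedFunctor W₁.Q W₂.Q)
  have hβ : NatTrans.CommShift β.symm.hom ℤ := inferInstance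
  -- Every morphism of the localization is, up to isomorphism, the image of one upstairs, so being
  -- triangulated can be tested after precomposition.
  have := Localization.essSurj_mapArrow W₁.Q W₁
  exact ⟨M.localizedFunctor W₁.Q W₂.Q, inferInstance,
    Functor.isTriangulated_of_precomp_iso β.symm, inferInstance, β.symm, hβ⟩

theorem exists_verdierEquivalence [F.IsEquivalence] (h : ∀ X, P X → Q (F.obj X))
    (h' : ∀ X, Q X → ∃ Y, P Y ∧ Nonempty (F.obj Y ≅ X)) :
    ∃ (Φ : P.triangEnvelope.trW.Localization ⥤ Q.triangEnvelope.trW.Localization)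
      (_ : Φ.CommShift ℤ), Φ.IsTriangulated ∧ Φ.IsEquivalence ∧
      ∃ α : P.triangEnvelope.trW.Q ⋙ Φ ≅ F ⋙ Q.triangEnvelope.trW.Q,
        NatTrans.CommShift α.hom ℤ :=
  have := isLocalizedEquivalence_verdierMorphism h h'
  exists_triangulated_localizedFunctor (verdierMorphism h)

end ThickClosures

/-! ### The equivalence of bounded derived categories. -/

section DerivedEquivalence

variable {C : Type u} [Category.{v} C] [Preadditive C] [HasZeroObject C] [HasBinaryBiproducts C]
  {D : Type u₂} [Category.{v₂} D] [Preadditive D] [HasZeroObject D] [HasBinaryBiproducts D]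
  (e : RightExactStructure C) (j : C ⥤ D) [j.Additive]

/-- Stalk complexes are compatible with additive functors. -/
def stalkCompMapKb : stalk C ⋙ mapKb j ≅ j ⋙ stalk D :=
  NatIso.ofComponents (fun X => (bounded D).isoMk ((HomotopyCategory.quotient _ _).mapIso
    ((HomologicalComplex.singleMapHomologicalComplex j (ComplexShape.up ℤ) 0).app X)))
    (fun f => ObjectProperty.hom_ext _ ((HomotopyCategory.quotient _ _).congr_map
      ((HomologicalComplex.singleMapHomologicalComplex j (ComplexShape.up ℤ) 0).hom.naturality f)))

variable {e j} [j.Full] [j.Faithful]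

theorem exists_derivedEquivalence (h₀ : e.R0Star) (hD : WeaklyIdempotentComplete D)
    (hj : ∀ X : D, ∃ A B : C, Nonempty (X ⊞ j.obj A ≅ j.obj B)) :
    ∃ (Φ : e.Db ⥤ (completedStructure e j h₀ hD hj).Db) (_ : Φ.CommShift ℤ),
      Φ.IsTriangulated ∧ Φ.IsEquivalence ∧
      (∃ α : e.Qb ⋙ Φ ≅ mapKb j ⋙ (completedStructure e j h₀ hD hj).Qb,
        NatTrans.CommShift α.hom ℤ) ∧
      Nonempty (e.toDb ⋙ Φ ≅ j ⋙ (completedStructure e j h₀ hD hj).toDb) := by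
  have := essSurj_mapKb hj
  have : (mapKb j).IsEquivalence := {}
  obtain ⟨Φ, hΦ, h₁, h₂, α, hα⟩ := exists_verdierEquivalence (F := mapKb j)
    (fun X hX => acyclicKb_mapKb h₀ hD hj hX) (fun X hX => exists_acyclic_preimage h₀ hD hj hX)
  exact ⟨Φ, hΦ, h₁, h₂, ⟨α, hα⟩, ⟨Functor.associator _ _ _ ≪≫ Functor.isoWhiskerLeft _ α ≪≫
    (Functor.associator _ _ _).symm ≪≫ Functor.isoWhiskerRight (stalkCompMapKb j) _ ≪≫
    Functor.associator _ _ _⟩⟩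

end DerivedEquivalence

/-! ### Kernels of retractions in full subcategories. -/

section WeakIdempotentCompleteness

variable {K : Type u} [Category.{v} K] [Preadditive K]

theorem weaklyIdempotentComplete_of_isIdempotentComplete [IsIdempotentComplete K] :
    WeaklyIdempotentComplete K := by
  intro X N r s hs
  obtain ⟨Y, i, p, hip, hpi⟩ := IsIdempotentComplete.idempotents_split X (𝟙 X - r ≫ s)
    (by simp [reassoc_of% hs])
  have hir : i ≫ r = 0 := by
    rw [← Category.id_comp i, ← hip, Category.assoc, Category.assoc, reassoc_of% hpi]
    simp [hs]
  refine hasKernel_iff.2 ⟨Y, i, hir, (SplitMono.mk p hip).mono, fun T t ht => ⟨t ≫ p, ?_⟩⟩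
  rw [Category.assoc, hpi, Preadditive.comp_sub, reassoc_of% ht]
  simp

theorem weaklyIdempotentComplete_fullSubcategory (hK : WeaklyIdempotentComplete K)
    {P : ObjectProperty K} (hP : ∀ ⦃X N Z : K⦄ (r : X ⟶ N) (s : N ⟶ X) (i : Z ⟶ X) (p : X ⟶ Z),
      P X → P N → s ≫ r = 𝟙 N → i ≫ p = 𝟙 Z → i ≫ r = 0 → p ≫ i = 𝟙 X - r ≫ s → P Z) :
    WeaklyIdempotentComplete P.FullSubcategory := by
  intro X N r s hs
  have hs' : s.hom ≫ r.hom = 𝟙 N.obj := P.ι.congr_map hs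
  obtain ⟨Z, i, p, h₁, h₂, h₃⟩ := hK.exists_splitting r.hom s.hom hs'
  refine hasKernel_iff.2 ⟨⟨Z, hP r.hom s.hom i p X.property N.property hs' h₁ h₂ h₃⟩,
    ObjectProperty.homMk i, ObjectProperty.hom_ext _ h₂,
    Functor.mono_of_mono_map P.ι (SplitMono.mk p h₁).mono,
    fun T t ht => ⟨ObjectProperty.homMk (t.hom ≫ p), ObjectProperty.hom_ext _ ?_⟩⟩
  have ht' : t.hom ≫ r.hom = 0 := P.ι.congr_map ht
  change (t.hom ≫ p) ≫ i = t.hom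
  rw [Category.assoc, h₃, Preadditive.comp_sub, reassoc_of% ht']
  simp

/-- A retraction splits off its kernel. -/
def splittingIso [HasBinaryBiproducts K] {X N Z : K} (r : X ⟶ N) (s : N ⟶ X) (i : Z ⟶ X)
    (p : X ⟶ Z) (h₁ : s ≫ r = 𝟙 N) (h₂ : i ≫ p = 𝟙 Z) (h₃ : i ≫ r = 0)
    (h₄ : p ≫ i = 𝟙 X - r ≫ s) : X ≅ N ⊞ Z where
  hom := biprod.lift r p
  inv := biprod.desc s i
  hom_inv_id := by simp [biprod.lift_desc, h₄]
  inv_hom_id := by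
    have : s ≫ p = 0 := by
      have : Mono i := (SplitMono.mk p h₂).mono
      rw [← cancel_mono i, Category.assoc, h₄]
      simp [reassoc_of% h₁]
    ext <;> simp [*]

/-- Interchange of the two middle summands. -/
def biprodInterchange [HasBinaryBiproducts K] (X Y Z W : K) :
    (X ⊞ Y) ⊞ (Z ⊞ W) ≅ (X ⊞ Z) ⊞ (Y ⊞ W) where
  hom := biprod.lift (biprod.map biprod.fst biprod.fst) (biprod.map biprod.snd biprod.snd)
  inv := biprod.lift (biprod.map biprod.fst biprod.fst) (biprod.map biprod.snd biprod.snd)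
  hom_inv_id := by ext <;> simp
  inv_hom_id := by ext <;> simp

/-- Rearrangement of four summands. -/
def biprodRearrange [HasBinaryBiproducts K] (Z N V U : K) :
    Z ⊞ ((N ⊞ V) ⊞ U) ≅ ((N ⊞ Z) ⊞ U) ⊞ V where
  hom := biprod.lift (biprod.lift (biprod.lift (biprod.snd ≫ biprod.fst ≫ biprod.fst) biprod.fst)
    (biprod.snd ≫ biprod.snd)) (biprod.snd ≫ biprod.fst ≫ biprod.snd)
  inv := biprod.lift (biprod.fst ≫ biprod.fst ≫ biprod.snd) (biprod.lift
    (biprod.lift (biprod.fst ≫ biprod.fst ≫ biprod.fst) biprod.snd) (biprod.fst ≫ biprod.snd))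
  hom_inv_id := by ext <;> simp
  inv_hom_id := by ext <;> simp

end WeakIdempotentCompleteness

/-! ### Objects with a complement in the image. -/

section Complemented

variable {C : Type u} [Category.{v} C] [Preadditive C] [HasZeroObject C] [HasBinaryBiproducts C]
  {K : Type u₂} [Category.{v₂} K] [Preadditive K] [HasBinaryBiproducts K]
  (j : C ⥤ K) [j.Additive]

/-- The objects that have a complement of the form `j.obj A` in an object of the form
`j.obj B`. -/
def complemented : ObjectProperty K :=
  fun X => ∃ A B : C, Nonempty (X ⊞ j.obj A ≅ j.obj B)

variable {j}

theorem complemented_of_iso {X Y : K} (φ : X ≅ Y) (h : complemented j X) : complemented j Y := by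
  obtain ⟨A, B, ⟨ψ⟩⟩ := h
  exact ⟨A, B, ⟨biprod.mapIso φ.symm (Iso.refl _) ≪≫ ψ⟩⟩

theorem complemented_biprod {X Y : K} (hX : complemented j X) (hY : complemented j Y) :
    complemented j (X ⊞ Y) := by
  obtain ⟨A, B, ⟨φ⟩⟩ := hX
  obtain ⟨A', B', ⟨φ'⟩⟩ := hY
  exact ⟨A ⊞ A', B ⊞ B', ⟨biprod.mapIso (Iso.refl _) (mapSumIso j A A') ≪≫
    biprodInterchange _ _ _ _ ≪≫ biprod.mapIso φ φ' ≪≫ (mapSumIso j B B').symm⟩⟩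

theorem complemented_obj (X : C) : complemented j (j.obj X) :=
  ⟨X, X ⊞ X, ⟨(mapSumIso j X X).symm⟩⟩

/-- As X ≅ N ⊞ Z, adding jB' ≅ N ⊞ jA' and jA to Z gives X ⊞ jA ⊞ jA' ≅ jB ⊞ jA'. -/
theorem complemented_of_splitting {X N Z : K} (r : X ⟶ N) (s : N ⟶ X) (i : Z ⟶ X) (p : X ⟶ Z)
    (hX : complemented j X) (hN : complemented j N) (h₁ : s ≫ r = 𝟙 N) (h₂ : i ≫ p = 𝟙 Z)
    (h₃ : i ≫ r = 0) (h₄ : p ≫ i = 𝟙 X - r ≫ s) : complemented j Z := by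
  obtain ⟨A, B, ⟨φ⟩⟩ := hX
  obtain ⟨A', B', ⟨φ'⟩⟩ := hN
  exact ⟨B' ⊞ A, B ⊞ A', ⟨biprod.mapIso (Iso.refl _) (mapSumIso j B' A ≪≫
    biprod.mapIso φ'.symm (Iso.refl _)) ≪≫ biprodRearrange _ _ _ _ ≪≫
    biprod.mapIso (biprod.mapIso (splittingIso r s i p h₁ h₂ h₃ h₄).symm (Iso.refl _) ≪≫ φ)
      (Iso.refl _) ≪≫ (mapSumIso j B A').symm⟩⟩

instance : (complemented j).IsClosedUnderIsomorphisms where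
  of_iso := complemented_of_iso

instance : (complemented j).IsClosedUnderBinaryProducts where
  limitsOfShape_le := by
    rintro X ⟨p⟩
    refine complemented_of_iso ?_ (complemented_biprod (p.prop_diag_obj (.mk .left))
      (p.prop_diag_obj (.mk .right)))
    exact IsLimit.conePointUniqueUpToIso (BinaryBiproduct.isLimit _ _)
      ((IsLimit.postcomposeHomEquiv (diagramIsoPair p.diag) _).2 p.isLimit)

instance : (complemented j).ContainsZero where
  exists_zero := ⟨j.obj 0, j.map_isZero (isZero_zero C), complemented_obj 0⟩

end Complemented

/-! ### The weak idempotent completion inside the idempotent completion. -/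

section Completion

variable (E : Type u) [Category.{v} E] [Preadditive E] [HasZeroObject E] [HasBinaryBiproducts E]

instance : HasFiniteBiproducts (Karoubi E) :=
  have : HasFiniteProducts E := hasFiniteProducts_of_has_binary_and_terminal
  have : HasFiniteBiproducts E := HasFiniteBiproducts.of_hasFiniteProducts
  inferInstance

instance : HasBinaryBiproducts (Karoubi E) := hasBinaryBiproducts_of_finite_biproducts _

theorem isWeaklyIdempotentCompleteEnvelope_complemented :
    IsWeaklyIdempotentCompleteEnvelope E (complemented (toKaroubi E)) where
  additive := .mk'
  contains X := complemented_obj X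
  complete := weaklyIdempotentComplete_fullSubcategory
    weaklyIdempotentComplete_of_isIdempotentComplete
    (fun _ _ _ r s i p => complemented_of_splitting r s i p)

/-- In every envelope the retraction has a kernel splitting the idempotent 1 - rs. Splittings of an
idempotent are unique up to isomorphism, so all these kernels agree with the one in the idempotent
completion, which therefore lies in the intersection. -/
theorem weaklyIdempotentComplete_weakIdempotentCompletion :
    WeaklyIdempotentComplete (WeakIdempotentCompletion E) := by
  refine weaklyIdempotentComplete_fullSubcategory
    weaklyIdempotentComplete_of_isIdempotentComplete ?_
  intro X N Z r s i p hX hN h₁ h₂ h₃ h₄ Q hQ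
  have := hQ.additive
  have : Q.IsClosedUnderIsomorphisms :=
    ObjectProperty.IsClosedUnderBinaryProducts.closedUnderIsomorphisms Q
  let X' : Q.FullSubcategory := ⟨X, hX Q hQ⟩
  let N' : Q.FullSubcategory := ⟨N, hN Q hQ⟩
  obtain ⟨Z', i', p', h₂', h₃', h₄'⟩ := hQ.complete.exists_splitting
    (ObjectProperty.homMk r : X' ⟶ N') (ObjectProperty.homMk s) (ObjectProperty.hom_ext _ h₁)
  replace h₂' : i'.hom ≫ p'.hom = 𝟙 Z'.obj := Q.ι.congr_map h₂'
  replace h₃' : i'.hom ≫ r = 0 := Q.ι.congr_map h₃'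
  replace h₄' : p'.hom ≫ i'.hom = 𝟙 X - r ≫ s := Q.ι.congr_map h₄'
  refine Q.prop_of_iso ⟨i'.hom ≫ p, i ≫ p'.hom, ?_, ?_⟩ Z'.property
  · rw [Category.assoc, reassoc_of% h₄, Preadditive.sub_comp, Preadditive.comp_sub]
    rw [Category.id_comp, Category.assoc, reassoc_of% h₃', zero_comp, sub_zero, h₂']
  · rw [Category.assoc, reassoc_of% h₄', Preadditive.sub_comp, Preadditive.comp_sub]
    rw [Category.id_comp, Category.assoc, reassoc_of% h₃, zero_comp, sub_zero, h₂]

instance : (toWeakIdempotentCompletion E).Full where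
  map_surjective f := ⟨(toKaroubi E).preimage f.hom,
    ObjectProperty.hom_ext _ ((toKaroubi E).map_preimage f.hom)⟩

instance : (toWeakIdempotentCompletion E).Faithful where
  map_injective h := (toKaroubi E).map_injective ((ObjectProperty.ι _).congr_map h)

variable {E}

theorem exists_complement_weakIdempotentCompletion (X : WeakIdempotentCompletion E) :
    ∃ A B : E, Nonempty (X ⊞ (toWeakIdempotentCompletion E).obj A ≅
      (toWeakIdempotentCompletion E).obj B) := by
  obtain ⟨A, B, ⟨φ⟩⟩ := X.property _ (isWeaklyIdempotentCompleteEnvelope_complemented E)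
  exact ⟨A, B, ⟨(weakIdempotentHull E).isoMk (mapSumIso (weakIdempotentHull E).ι _ _ ≪≫ φ)⟩⟩

theorem retractConflation_iff_karoubiConflation (e : RightExactStructure E)
    (S : ShortComplex (WeakIdempotentCompletion E)) :
    retractConflation e (toWeakIdempotentCompletion E) S ↔
      e.karoubiConflation (S.map (weakIdempotentHull E).ι) := by
  refine exists_congr fun T => and_congr_right fun _ => ⟨?_, ?_⟩
  · rintro ⟨R⟩
    exact ⟨R.map (weakIdempotentHull E).ι.mapShortComplex⟩
  · rintro ⟨R⟩
    have h₁ := congrArg ShortComplex.Hom.τ₁ R.retract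
    have h₂ := congrArg ShortComplex.Hom.τ₂ R.retract
    have h₃ := congrArg ShortComplex.Hom.τ₃ R.retract
    exact ⟨{
      i :=
        { τ₁ := ObjectProperty.homMk R.i.τ₁
          τ₂ := ObjectProperty.homMk R.i.τ₂
          τ₃ := ObjectProperty.homMk R.i.τ₃
          comm₁₂ := ObjectProperty.hom_ext _ R.i.comm₁₂
          comm₂₃ := ObjectProperty.hom_ext _ R.i.comm₂₃ }
      r :=
        { τ₁ := ObjectProperty.homMk R.r.τ₁
          τ₂ := ObjectProperty.homMk R.r.τ₂
          τ₃ := ObjectProperty.homMk R.r.τ₃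
          comm₁₂ := ObjectProperty.hom_ext _ R.r.comm₁₂
          comm₂₃ := ObjectProperty.hom_ext _ R.r.comm₂₃ }
      retract := ShortComplex.hom_ext _ _ (ObjectProperty.hom_ext _ h₁)
        (ObjectProperty.hom_ext _ h₂) (ObjectProperty.hom_ext _ h₃) }⟩

end Completion

end

end RightExact


open RightExact in
theorem mainTheorem6 {E : Type u} [Category.{v} E] [Preadditive E] [HasZeroObject E]
    [HasBinaryBiproducts E]
    (e : RightExactStructure E) (h₀ : e.R0Star) :
    WeaklyIdempotentComplete (WeakIdempotentCompletion E) ∧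
    (toWeakIdempotentCompletion E).Full ∧ (toWeakIdempotentCompletion E).Faithful ∧
    ∃ e' : RightExactStructure (WeakIdempotentCompletion E),
      (∀ S : ShortComplex (WeakIdempotentCompletion E),
        e'.conflation S ↔ e.karoubiConflation (S.map (weakIdempotentHull E).ι)) ∧
      e'.R3 ∧
      IsExact e e' (toWeakIdempotentCompletion E) ∧
      IsTwoUniversal.{w', w} e e' (toWeakIdempotentCompletion E) ∧
      ∃ (Φ : e.Db ⥤ e'.Db) (_ : Φ.CommShift ℤ),
        Φ.IsTriangulated ∧ Φ.IsEquivalence ∧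
        (∃ α : e.Qb ⋙ Φ ≅ mapKb (toWeakIdempotentCompletion E) ⋙ e'.Qb,
          NatTrans.CommShift α.hom ℤ) ∧
        Nonempty (e.toDb ⋙ Φ ≅ toWeakIdempotentCompletion E ⋙ e'.toDb) := by
  have hD := weaklyIdempotentComplete_weakIdempotentCompletion E
  have hj := exists_complement_weakIdempotentCompletion (E := E)
  exact ⟨hD, inferInstance, inferInstance,
    completedStructure e (toWeakIdempotentCompletion E) h₀ hD hj,
    retractConflation_iff_karoubiConflation e, completedStructure_r3 h₀ hD hj,
    isExact_completedStructure h₀ hD hj, isTwoUniversal_completedStructure h₀ hD hj,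
    exists_derivedEquivalence h₀ hD hj⟩
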